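/- Let $d\ge 1$, let $\nu=(0,\dots,0,1)^\top\in\mathbb R^d$, and let $\Lambda\subset\mathbb R^d$ be a lattice with dual lattice $\Lambda^*=\{g\in\mathbb R^d: g\cdot r\in\mathbb Z \text{ for all } r\in\Lambda\}$; let $\kappa_*>0$ be the minimal distance between different points of $\Lambda^*$. For a wave vector $k_0\in\mathbb R^d$ with $k_0\cdot\nu>0$ put $$\rho_g=(k_0+g)\cdot\nu,\qquad \sigma_g=|k_0|^2-|k_0+g|^2,\qquad \mathbb S=\{g\in\mathbb R^d:\ |k_0+g|=|k_0|\},\qquad T_{k_0}=\{\eta\in\mathbb R^d:\ \eta\cdot k_0=0\},$$ $$G_{1/2}=\{g\in\Lambda^*:\ \rho_g\ge \tfrac12\rho_0\},\qquad G_{\rm LOLZ}=\{g\in\Lambda^*\cap T_{k_0}:\ \operatorname{dist}(g,\mathbb S)\le \kappa_*/2\}.$$ Let the coefficients $U_g\in\mathbb C$ $(g\in\Lambda^*)$ satisfy $U_{-g}=\overline{U_g}$ and $|U_g|\le C_U e^{-\alpha_U|g|}$ with $C_U,\alpha_U>0$. For $G\subset\Lambda^*$ put $\|\varphi\|_G=\big(\sum_{g\in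 G}\rho_g|\varphi_g|^2\big)^{1/2}$ and $\mathfrak H(G)=\{\varphi\in\ell^2(G):\|\varphi\|_G<\infty\}$. A solution of DHW$_G$ is a function $\psi\in C^0(\mathbb R;\mathfrak H(G))$ with differentiable components such that $$\frac{\rho_g}{\pi}\,\frac{d}{dz}\psi_g(z)=i\Big(\sigma_g\psi_g(z)+\sum_{h\in G}U_{g-h}\psi_h(z)\Big)\quad (g\in G,\ z\in\mathbb R),\qquad \psi(0)=\delta:=(\delta_{0,g})_g .$$ Let $\psi^\gamma$ (for $\gamma=1/2$) and $\psi^{\rm LOLZ}$ be the solutions of DHW$_{G_{1/2}}$ and DHW$_{G_{\rm LOLZ}}$. **Theorem (LOLZ approximation).** Given $d$, $N_0>0$, $\alpha_U>0$, a length scale $\alpha_*>0$, $\kappa_*>0$, and constants $h_0>0$, $c_0>0$, there exist $k_*>0$ and $N_1>0$, depending only on these data, such that the following holds for all lattices $\Lambda$ whose dual lattice has minimal distance $\kappa_*$, all $C_U>0$, all $U$ as above, and all $k_0$ such that $\Lambda^*\cap T_{k_0}$ spans a space of dimension $d-1$, all points of $\Lambda^*\setminus T_{k_0}$ have distance at least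 $h_0$ from $T_{k_0}$, and $k_0\cdot\nu\ge c_0|k_0|$. If $$|k_0|\ge k_*\quad\text{and}\quad z_*\le N_0\,|\alpha_*k_0|^{1/3}\,\frac{|k_0|}{C_U},$$ then $G_{\rm LOLZ}\subset G_{1/2}$ and, for all $z\in[0,z_*]$, $$\big\|\psi^{\rm LOLZ}(z)-\psi^\gamma(z)|_{G_{\rm LOLZ}}\big\|_{G_{\rm LOLZ}}\le N_1\Big(\frac1{|\alpha_*k_0|^2}+\frac{\alpha_*C_U^2}{|k_0|^2}\,z_*\Big)\|\delta\|_{G_{1/2}} .$$ (For a fixed crystal and a fixed admissible direction of $k_0$ with $k_0\cdot\nu>0$, suitable $h_0$ and $c_0$ always exist.) -/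

import Mathlib

open scoped RealInnerProductSpace

noncomputable section

namespace DHW

/-- The space `ℝ^d` with `d = n + 1 ≥ 1`, carrying the Euclidean norm. -/
abbrev Space (n : ℕ) : Type := EuclideanSpace ℝ (Fin (n + 1))

/-- The normal `ν = (0, …, 0, 1)` to the crystal surface. -/
def nu (n : ℕ) : Space n := EuclideanSpace.single (Fin.last n) (1 : ℝ)

/-- The dual lattice `Λ* = {g | g · r ∈ ℤ for all r ∈ Λ}`. -/
def dualLattice {n : ℕ} (Λ : Submodule ℤ (Space n)) : Set (Space n) :=
  {g | ∀ r ∈ Λ, ∃ m : ℤ, ⟪g, r⟫ = (m : ℝ)}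

/-- `κ_*`, the minimal distance between different points of the dual lattice. -/
def kappaStar {n : ℕ} (Λ : Submodule ℤ (Space n)) : ℝ := (dualLattice Λ).infsep

/-- `ρ_g = (k₀ + g) · ν`. -/
def rho {n : ℕ} (k₀ g : Space n) : ℝ := ⟪k₀ + g, nu n⟫

/-- `σ_g = |k₀|² - |k₀ + g|²`. -/
def sigma {n : ℕ} (k₀ g : Space n) : ℝ := ‖k₀‖ ^ 2 - ‖k₀ + g‖ ^ 2

/-- The Ewald sphere, the zero set of `σ`. -/
def ewaldSphere {n : ℕ} (k₀ : Space n) : Set (Space n) := {g | sigma k₀ g = 0}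

/-- The tangent plane `T = {η | η · k₀ = 0}` to the Ewald sphere at `g = 0`. -/
def tangentPlane {n : ℕ} (k₀ : Space n) : Set (Space n) := {η | ⟪η, k₀⟫ = 0}

/-- `G_γ = {g ∈ Λ* | ρ_g ≥ γ ρ_0}`. -/
def gGamma {n : ℕ} (Λ : Submodule ℤ (Space n)) (k₀ : Space n) (γ : ℝ) : Set (Space n) :=
  {g | g ∈ dualLattice Λ ∧ γ * rho k₀ 0 ≤ rho k₀ g}

/-- The lowest-order Laue zone: the points of `Λ* ∩ T` at distance at most `κ_* / 2` from the
Ewald sphere. -/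
def gLOLZ {n : ℕ} (Λ : Submodule ℤ (Space n)) (k₀ : Space n) : Set (Space n) :=
  {g | g ∈ dualLattice Λ ∧ g ∈ tangentPlane k₀ ∧
    Metric.infDist g (ewaldSphere k₀) ≤ kappaStar Λ / 2}

/-- `‖φ‖_G = (∑_{g ∈ G} ρ_g |φ_g|²)^{1/2}`; only the restriction of `φ` to `G` matters. -/
def normG {n : ℕ} (k₀ : Space n) (G : Set (Space n)) (φ : Space n → ℂ) : ℝ :=
  Real.sqrt (∑' g : G, rho k₀ g * ‖φ g‖ ^ 2)

/-- Membership (of the restriction to `G`) in the Hilbert space `𝔥(G)`: `φ ∈ ℓ²(G)` and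
`‖φ‖_G < ∞`. -/
def MemH {n : ℕ} (k₀ : Space n) (G : Set (Space n)) (φ : Space n → ℂ) : Prop :=
  (Summable fun g : G => ‖φ g‖ ^ 2) ∧ (Summable fun g : G => rho k₀ g * ‖φ g‖ ^ 2)

/-- The incoming beam `δ = (δ_{0,g})_g`. -/
def delta (n : ℕ) : Space n → ℂ := Set.indicator {0} (fun _ => 1)

/-- `ψ ∈ C⁰(ℝ; 𝔥(G))` solves the Darwin–Howie–Whelan equations on the beam set `G`,
`(ρ_g / π) ψ_g' = i (σ_g ψ_g + ∑_{h ∈ G} U_{g-h} ψ_h)` for `g ∈ G`, with `ψ(0) = δ`.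
The family is extended by `0` to indices outside `G`. -/
structure IsSolution {n : ℕ} (k₀ : Space n) (U : Space n → ℂ) (G : Set (Space n))
    (ψ : ℝ → Space n → ℂ) : Prop where
  eq_zero_outside : ∀ z : ℝ, ∀ g, g ∉ G → ψ z g = 0
  memH : ∀ z : ℝ, MemH k₀ G (ψ z)
  continuous : ∀ z₀ : ℝ,
    Filter.Tendsto (fun z : ℝ => normG k₀ G (fun g => ψ z g - ψ z₀ g)) (nhds z₀) (nhds 0)
  summable : ∀ z : ℝ, ∀ g ∈ G, Summable fun h : G => U (g - h) * ψ z h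
  differentiable : ∀ g ∈ G, Differentiable ℝ fun t : ℝ => ψ t g
  equation : ∀ z : ℝ, ∀ g ∈ G,
    ((rho k₀ g / Real.pi : ℝ) : ℂ) * deriv (fun t : ℝ => ψ t g) z =
      Complex.I * ((sigma k₀ g : ℂ) * ψ z g + ∑' h : G, U (g - h) * ψ z h)
  initial : ψ 0 = delta n

end DHW

end

open Filter Topology

/-! The substitution `v_g = √ρ_g ψ_g` turns the system into `v' = i (a v + B v)` in `ℓ²(G_{1/2})`,
with real unbounded diagonal `a_g = π σ_g / ρ_g` and Hermitian `B` with entries `π U_{g-h} / √(ρ_g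
ρ_h)`. Since `ρ ≥ c₀|k₀|/2`, the Schur test gives `‖B‖ ≤ β = q C_U / |k₀|`, where `q` depends only
on the data because exponential sums over `κ_*`-separated sets are uniformly bounded.

Let `L` be the LOLZ, `P` and `Q` the projections onto `L` and its complement, `u` the reduced
solution. A direct estimate of `P v - u` only uses the forcing `P B Q v` and would give `(βz)²`, too
weak for long `z`. The gain is non-resonance: in the paraxial ball `|g|² ≤ μ|k₀|`, `|a|` is at most
`π h₀/4` on `L` and at least `π h₀/2` off `L`. The entrywise solution `X` of a Sylvester equation,
`x_ij = b_ij / (a_i - a_j)`, makes `P v - u + X v` free of this forcing inside the ball; what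
remains has size `β²/c` with `c = π h₀/4` and grows only linearly in `z`
(`norm_reduction_error_le`).

Couplings leaving the ball have no gap, but the beam starts at `g = 0` and `U` decays. A truncated
exponential weight, propagated with loss `exp(βz)` (`norm_weight_mul_le`), shows that they
contribute at most `exp(-(α_U/2) √(μ|k₀|)) β exp(βz) z`. The restriction on `z_*` makes `βz` at most
of order `|k₀|^{1/3}`, which is beaten by `|k₀|^{1/2}`; this yields the term `1/|α_* k₀|²`. -/

/-- A Gronwall inequality for the square root of a nonnegative function. -/
theorem sqrt_le_of_deriv_le {y y' : ℝ → ℝ} {c d η T : ℝ} (hc : 0 ≤ c) (hd : 0 ≤ d)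
    (hη : 0 < η) (hT : 0 ≤ T) (hy : ∀ s, 0 ≤ y s) (hder : ∀ s, HasDerivAt y (y' s) s)
    (hle : ∀ s ∈ Set.Icc 0 T, y' s ≤ 2 * √(y s) * (c * √(y s) + d)) :
    √(y T) ≤ Real.exp (c * T) * (√(y 0) + η + d * T) := by
  -- The shift by `η ^ 2` keeps the square root differentiable where `y` vanishes.
  set g : ℝ → ℝ := fun s => Real.exp (-c * s) * √(y s + η ^ 2) - d * s with hg
  have hpos : ∀ s, 0 < y s + η ^ 2 := fun s => by have := hy s; positivity
  have hgder : ∀ s, HasDerivAt g (Real.exp (-c * s) * (-c * 1) * √(y s + η ^ 2) +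
      Real.exp (-c * s) * (y' s / (2 * √(y s + η ^ 2))) - d * 1) s := by
    intro s
    exact ((((hasDerivAt_id s).const_mul (-c)).exp).mul
      (((hder s).add_const (η ^ 2)).sqrt (hpos s).ne')).sub ((hasDerivAt_id s).const_mul d)
  have hanti : AntitoneOn g (Set.Icc 0 T) := by
    refine antitoneOn_of_deriv_nonpos (convex_Icc 0 T)
      (fun s _ => (hgder s).continuousAt.continuousWithinAt)
      (fun s _ => (hgder s).differentiableAt.differentiableWithinAt) ?_
    intro s hs
    rw [interior_Icc] at hs
    rw [(hgder s).deriv]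
    set r := √(y s + η ^ 2)
    have hr : 0 < r := Real.sqrt_pos.2 (hpos s)
    have hyr : √(y s) ≤ r := Real.sqrt_le_sqrt (by nlinarith)
    have hy0 := Real.sqrt_nonneg (y s)
    have h1 : y' s / (2 * r) ≤ c * r + d := by
      rw [div_le_iff₀ (by positivity)]
      refine (hle s ⟨hs.1.le, hs.2.le⟩).trans ?_
      have : √(y s) * (c * √(y s) + d) ≤ r * (c * r + d) := by gcongr
      linarith
    have h2 : Real.exp (-c * s) ≤ 1 := Real.exp_le_one_iff.2 (by nlinarith [hs.1])
    have h3 := Real.exp_pos (-c * s)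
    nlinarith [mul_le_mul_of_nonneg_left h1 h3.le]
  have h := hanti ⟨le_rfl, hT⟩ ⟨hT, le_rfl⟩ hT
  simp only [hg, mul_zero, Real.exp_zero, one_mul, sub_zero] at h
  have h0 : √(y 0 + η ^ 2) ≤ √(y 0) + η := by
    rw [Real.sqrt_le_left (by positivity)]
    nlinarith [Real.sq_sqrt (hy 0), mul_nonneg (Real.sqrt_nonneg (y 0)) hη.le]
  have h1 : √(y T) ≤ √(y T + η ^ 2) := Real.sqrt_le_sqrt (by nlinarith)
  have h2 : √(y T + η ^ 2) = Real.exp (c * T) * (Real.exp (-c * T) * √(y T + η ^ 2)) := by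
    rw [← mul_assoc, ← Real.exp_add]; simp
  rw [h2] at h1
  exact h1.trans (mul_le_mul_of_nonneg_left (by linarith) (Real.exp_pos _).le)

/-! ### Energy estimate in `ℓ²` with an unbounded real diagonal -/

section Energy

variable {ι : Type*}

/-- The square of the norm of a finite section of an element of `ℓ²`. -/
theorem lp_norm_sum_single_sq [DecidableEq ι] (x : lp (fun _ : ι => ℂ) 2) (F : Finset ι) :
    ‖∑ i ∈ F, lp.single 2 i (x i)‖ ^ 2 = ∑ i ∈ F, ‖x i‖ ^ 2 := by
  have h := lp.norm_sum_single (E := fun _ : ι => ℂ) (p := 2) (by norm_num) (⇑x) F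
  simpa using h

theorem lp_norm_sub_sum_single_sq [DecidableEq ι] (x : lp (fun _ : ι => ℂ) 2) (F : Finset ι) :
    ‖x - ∑ i ∈ F, lp.single 2 i (x i)‖ ^ 2 = ‖x‖ ^ 2 - ∑ i ∈ F, ‖x i‖ ^ 2 := by
  have h := lp.norm_compl_sum_single (E := fun _ : ι => ℂ) (p := 2) (by norm_num) x F
  simpa using h

theorem continuous_lp_apply {v : ℝ → lp (fun _ : ι => ℂ) 2} (hv : Continuous v) (i : ι) :
    Continuous fun s => v s i :=
  (lp.lipschitzWith_one_eval (E := fun _ : ι => ℂ) 2 i).continuous.comp hv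

/-- The tails of a continuous curve in `ℓ²` are uniformly small on compact intervals. -/
theorem exists_finset_norm_sub_sum_single_le [DecidableEq ι] {v : ℝ → lp (fun _ : ι => ℂ) 2}
    (hv : Continuous v) (T : ℝ) {ε : ℝ} (hε : 0 < ε) :
    ∃ F : Finset ι, ∀ s ∈ Set.Icc 0 T, ‖v s - ∑ i ∈ F, lp.single 2 i (v s i)‖ ≤ ε := by
  have h : TendstoUniformlyOn
      (fun (F : Finset ι) s => ‖v s - ∑ i ∈ F, lp.single 2 i (v s i)‖ ^ 2)
      (fun _ => 0) atTop (Set.Icc 0 T) := by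
    -- Dini's theorem: the squared tails are continuous in `s` and decrease to zero along the finite
    -- sets.
    refine Antitone.tendstoUniformlyOn_of_forall_tendsto isCompact_Icc ?_ ?_
      continuousOn_const ?_
    · intro F
      simp only [lp_norm_sub_sum_single_sq]
      exact Continuous.continuousOn ((hv.norm.pow 2).sub
        (continuous_finsetSum F fun i _ => (continuous_lp_apply hv i).norm.pow 2))
    · intro s _ F F' hF
      simp only [lp_norm_sub_sum_single_sq]
      have := Finset.sum_le_sum_of_subset_of_nonneg (f := fun i => ‖v s i‖ ^ 2) hF
        (fun i _ _ => by positivity)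
      linarith
    · intro s _
      have h1 := lp.hasSum_single (E := fun _ : ι => ℂ) (p := 2) (by norm_num) (v s)
      have h2 := ((tendsto_const_nhds (x := v s)).sub h1).norm.pow 2
      simpa using h2
  obtain ⟨F, hF⟩ := (Metric.tendstoUniformlyOn_iff.1 h (ε ^ 2) (by positivity)).exists
  refine ⟨F, fun s hs => ?_⟩
  have := hF s hs
  rw [dist_comm, Real.dist_eq, sub_zero, abs_of_nonneg (by positivity)] at this
  exact (pow_le_pow_iff_left₀ (norm_nonneg _) hε.le two_ne_zero).1 this.le

theorem lp_inner_sum_single_left [DecidableEq ι] (x y : lp (fun _ : ι => ℂ) 2) (F : Finset ι) :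
    inner ℂ (∑ i ∈ F, lp.single 2 i (x i)) y = ∑ i ∈ F, (starRingEnd ℂ) (x i) * y i := by
  rw [sum_inner]
  refine Finset.sum_congr rfl fun i _ => ?_
  rw [lp.inner_single_left]
  simp [mul_comm]

/-- The energy estimate for `v' = i (a v + B v + f)` in `ℓ²`, where `a` is a possibly unbounded
real diagonal, `B` is bounded with real quadratic form, and the equation holds componentwise. -/
theorem norm_le_of_schrodinger (a : ι → ℝ)
    (B : lp (fun _ : ι => ℂ) 2 →L[ℂ] lp (fun _ : ι => ℂ) 2)
    (hB : ∀ x, (inner ℂ x (B x)).im = 0) {v f : ℝ → lp (fun _ : ι => ℂ) 2} (hv : Continuous v)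
    (hder : ∀ s i, HasDerivAt (fun t => v t i)
      (Complex.I * ((a i : ℂ) * v s i + B (v s) i + f s i)) s)
    {c d T : ℝ} (hc : 0 ≤ c) (hd : 0 ≤ d) (hT : 0 ≤ T)
    (hf : ∀ s ∈ Set.Icc 0 T, ‖f s‖ ≤ c * ‖v s‖ + d) :
    ‖v T‖ ≤ Real.exp (c * T) * (‖v 0‖ + d * T) := by
  classical
  -- Only the components are differentiable and `a v` need not lie in `ℓ²`, so the energy of a
  -- finite section is differentiated; its tail costs `ε`, which tends to zero at the end.
  have key : ∀ ε > 0, ‖v T‖ ≤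
      Real.exp (c * T) * (‖v 0‖ + ε + (d + (‖B‖ + c) * ε) * T) + ε := by
    intro ε hε
    obtain ⟨F, hF⟩ := exists_finset_norm_sub_sum_single_le hv T hε
    set P : ℝ → lp (fun _ : ι => ℂ) 2 := fun s => ∑ i ∈ F, lp.single 2 i (v s i) with hP
    set y : ℝ → ℝ := fun s => ∑ i ∈ F, ‖v s i‖ ^ 2 with hy
    have hPy : ∀ s, √(y s) = ‖P s‖ := fun s => by
      rw [hy, hP]
      simp only [← lp_norm_sum_single_sq]
      exact Real.sqrt_sq (norm_nonneg _)
    -- The diagonal drops out: `a i` is real, so `I * a i * v s i` is orthogonal to `v s i` in the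
    -- real inner product.
    have hyder : ∀ s, HasDerivAt y (-2 * (inner ℂ (P s) (B (v s) + f s)).im) s := by
      intro s
      have h1 : ∀ i ∈ F, HasDerivAt (fun t => ‖v t i‖ ^ 2)
          (2 * inner ℝ (v s i) (Complex.I * ((a i : ℂ) * v s i + B (v s) i + f s i))) s :=
        fun i _ => (hder s i).norm_sq
      have h2 := HasDerivAt.fun_sum h1
      refine h2.congr_deriv (Eq.symm ?_)
      rw [hP, lp_inner_sum_single_left, Complex.im_sum, Finset.mul_sum]
      refine Finset.sum_congr rfl fun i _ => ?_
      rw [Complex.inner, lp.coeFn_add, Pi.add_apply]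
      simp only [Complex.mul_re, Complex.mul_im, Complex.conj_re, Complex.conj_im, Complex.I_re,
        Complex.I_im, Complex.add_re, Complex.add_im, Complex.ofReal_re, Complex.ofReal_im]
      ring
    have hle : ∀ s ∈ Set.Icc 0 T, -2 * (inner ℂ (P s) (B (v s) + f s)).im ≤
        2 * √(y s) * (c * √(y s) + (d + (‖B‖ + c) * ε)) := by
      intro s hs
      -- The part `B (P s)` contributes nothing because the quadratic form is real; the rest
      -- involves only the tail and `f`.
      have h1 : B (v s) + f s = B (P s) + (B (v s - P s) + f s) := by
        rw [map_sub]; abel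
      rw [h1, inner_add_right, Complex.add_im, hB, zero_add, hPy]
      have h2 : ‖inner ℂ (P s) (B (v s - P s) + f s)‖ ≤ ‖P s‖ * ‖B (v s - P s) + f s‖ :=
        norm_inner_le_norm _ _
      have h3 := (Complex.abs_im_le_norm _).trans h2
      have h4 : ‖B (v s - P s) + f s‖ ≤ ‖B‖ * ε + (c * ‖v s‖ + d) :=
        (norm_add_le _ _).trans (add_le_add ((B.le_opNorm _).trans
          (mul_le_mul_of_nonneg_left (hF s hs) (norm_nonneg _))) (hf s hs))
      have h5 : ‖v s‖ ≤ ‖P s‖ + ε := by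
        calc ‖v s‖ = ‖P s + (v s - P s)‖ := by rw [add_sub_cancel]
          _ ≤ _ := (norm_add_le _ _).trans (by gcongr; exact hF s hs)
      have h6 : ‖B (v s - P s) + f s‖ ≤ c * ‖P s‖ + (d + (‖B‖ + c) * ε) := by
        nlinarith [mul_le_mul_of_nonneg_left h5 hc]
      have h7 := mul_le_mul_of_nonneg_left h6 (norm_nonneg (P s))
      have h8 := neg_abs_le (inner ℂ (P s) (B (v s - P s) + f s)).im
      linarith
    have hB0 := norm_nonneg B
    have h := sqrt_le_of_deriv_le hc (by positivity : 0 ≤ d + (‖B‖ + c) * ε) hε hT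
      (fun s => Finset.sum_nonneg fun i _ => by positivity) hyder hle
    rw [hPy, hPy] at h
    have h0 : ‖P 0‖ ≤ ‖v 0‖ := by
      have h1 := lp_norm_sum_single_sq (v 0) F
      have h2 := lp_norm_sub_sum_single_sq (v 0) F
      refine (pow_le_pow_iff_left₀ (norm_nonneg _) (norm_nonneg _) two_ne_zero).1 ?_
      simp only [hP]
      nlinarith [sq_nonneg ‖v 0 - ∑ i ∈ F, lp.single 2 i (v 0 i)‖]
    have hTn : ‖v T‖ ≤ ‖P T‖ + ε := by
      calc ‖v T‖ = ‖P T + (v T - P T)‖ := by rw [add_sub_cancel]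
        _ ≤ _ := (norm_add_le _ _).trans (by gcongr; exact hF T ⟨hT, le_rfl⟩)
    refine hTn.trans (add_le_add_left (h.trans ?_) ε)
    gcongr
  have hlim : Tendsto (fun ε : ℝ => Real.exp (c * T) *
      (‖v 0‖ + ε + (d + (‖B‖ + c) * ε) * T) + ε) (𝓝[>] 0) (𝓝 (Real.exp (c * T) *
      (‖v 0‖ + 0 + (d + (‖B‖ + c) * 0) * T) + 0)) := by
    refine tendsto_nhdsWithin_of_tendsto_nhds (Continuous.tendsto ?_ 0)
    fun_prop
  have := ge_of_tendsto hlim (eventually_nhdsWithin_of_forall key)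
  simpa using this

end Energy

/-! ### Schur test and the operators it defines -/

section Schur

variable {ι : Type*}

/-- The hypothesis of the Schur test: all absolute row and column sums of the infinite matrix `M`
are at most `C`. -/
structure SchurBound (M : ι → ι → ℂ) (C : ℝ) : Prop where
  row : ∀ i (F : Finset ι), ∑ j ∈ F, ‖M i j‖ ≤ C
  col : ∀ j (F : Finset ι), ∑ i ∈ F, ‖M i j‖ ≤ C

namespace SchurBound

variable {M N : ι → ι → ℂ} {C : ℝ}

theorem of_norm_le (h : SchurBound M C) {r : ℝ} (hr : 0 ≤ r)
    (hN : ∀ i j, ‖N i j‖ ≤ r * ‖M i j‖) : SchurBound N (r * C) where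
  row i F := (Finset.sum_le_sum fun j _ => hN i j).trans <| by
    rw [← Finset.mul_sum]; exact mul_le_mul_of_nonneg_left (h.row i F) hr
  col j F := (Finset.sum_le_sum fun i _ => hN i j).trans <| by
    rw [← Finset.mul_sum]; exact mul_le_mul_of_nonneg_left (h.col j F) hr

theorem mono (h : SchurBound M C) (hN : ∀ i j, ‖N i j‖ ≤ ‖M i j‖) : SchurBound N C := by
  simpa using h.of_norm_le zero_le_one (N := N) (by simpa using hN)

theorem nonneg [Nonempty ι] (h : SchurBound M C) : 0 ≤ C := by
  simpa using h.row (Classical.arbitrary ι) ∅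

theorem summable_norm (h : SchurBound M C) (i : ι) : Summable fun j => ‖M i j‖ :=
  summable_of_sum_le (fun _ => norm_nonneg _) (h.row i)

theorem summable_norm_mul (h : SchurBound M C) (x : lp (fun _ : ι => ℂ) 2) (i : ι) :
    Summable fun j => ‖M i j‖ * ‖x j‖ :=
  Summable.of_nonneg_of_le (fun j => by positivity)
    (fun j => mul_le_mul_of_nonneg_left (lp.norm_apply_le_norm two_ne_zero x j) (norm_nonneg _))
    ((h.summable_norm i).mul_right ‖x‖)

theorem summable_mul (h : SchurBound M C) (x : lp (fun _ : ι => ℂ) 2) (i : ι) :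
    Summable fun j => M i j * x j :=
  Summable.of_norm (by simpa using h.summable_norm_mul x i)

/-- Cauchy–Schwarz with weights `‖M i j‖` uses one row sum; exchanging the summations uses one
column sum. -/
theorem sum_norm_tsum_sq_le (h : SchurBound M C) (x : lp (fun _ : ι => ℂ) 2) (F : Finset ι) :
    ∑ i ∈ F, ‖∑' j, M i j * x j‖ ^ 2 ≤ (C * ‖x‖) ^ 2 := by
  rcases isEmpty_or_nonempty ι with hι | hι
  · rw [Finset.eq_empty_of_isEmpty F]; simp; positivity
  have hC := h.nonneg
  have hx2 : HasSum (fun j => ‖x j‖ ^ 2) (‖x‖ ^ 2) := by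
    simpa using lp.hasSum_norm (E := fun _ : ι => ℂ) (p := 2) (by norm_num) x
  have hs : ∀ i, Summable fun j => ‖M i j‖ * ‖x j‖ ^ 2 := fun i =>
    Summable.of_nonneg_of_le (fun j => by positivity)
      (fun j => mul_le_mul_of_nonneg_right
        ((Finset.sum_singleton (fun j => ‖M i j‖) j).symm.le.trans (h.row i {j}))
        (by positivity)) (hx2.summable.mul_left C)
  have hrow : ∀ i, ‖∑' j, M i j * x j‖ ^ 2 ≤ C * ∑' j, ‖M i j‖ * ‖x j‖ ^ 2 := by
    intro i
    have h1 : ‖∑' j, M i j * x j‖ ≤ ∑' j, ‖M i j‖ * ‖x j‖ := by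
      refine (norm_tsum_le_tsum_norm (by simpa using h.summable_norm_mul x i)).trans ?_
      simp
    have h2 : (∑' j, ‖M i j‖ * ‖x j‖) ^ 2 ≤ (∑' j, ‖M i j‖) * ∑' j, ‖M i j‖ * ‖x j‖ ^ 2 := by
      refine le_of_tendsto_of_tendsto
        ((show Tendsto (fun F : Finset ι => ∑ j ∈ F, ‖M i j‖ * ‖x j‖) atTop _ from
          (h.summable_norm_mul x i).hasSum).pow 2)
        ((show Tendsto (fun F : Finset ι => ∑ j ∈ F, ‖M i j‖) atTop _ from
          (h.summable_norm i).hasSum).mul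
        (show Tendsto (fun F : Finset ι => ∑ j ∈ F, ‖M i j‖ * ‖x j‖ ^ 2) atTop _ from
          (hs i).hasSum)) (Eventually.of_forall fun F => ?_)
      refine Finset.sum_sq_le_sum_mul_sum_of_sq_le_mul F (fun _ _ => norm_nonneg _)
        (fun _ _ => by positivity) fun j _ => le_of_eq (by ring)
    have h3 : ∑' j, ‖M i j‖ ≤ C := (h.summable_norm i).tsum_le_of_sum_le (h.row i)
    calc _ ≤ _ := pow_le_pow_left₀ (norm_nonneg _) h1 2
      _ ≤ _ := h2
      _ ≤ _ := mul_le_mul_of_nonneg_right h3 (tsum_nonneg fun _ => by positivity)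
  calc _ ≤ ∑ i ∈ F, C * ∑' j, ‖M i j‖ * ‖x j‖ ^ 2 := Finset.sum_le_sum fun i _ => hrow i
    _ = C * ∑' j, (∑ i ∈ F, ‖M i j‖) * ‖x j‖ ^ 2 := by
      rw [← Finset.mul_sum, ← Summable.tsum_finsetSum fun i _ => hs i]
      simp only [Finset.sum_mul]
    _ ≤ C * ∑' j, C * ‖x j‖ ^ 2 := by
      refine mul_le_mul_of_nonneg_left ?_ hC
      have hle : ∀ j, (∑ i ∈ F, ‖M i j‖) * ‖x j‖ ^ 2 ≤ C * ‖x j‖ ^ 2 := fun j =>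
        mul_le_mul_of_nonneg_right (h.col j F) (by positivity)
      exact Summable.tsum_le_tsum hle (Summable.of_nonneg_of_le (fun j => by positivity) hle
        (hx2.summable.mul_left C)) (hx2.summable.mul_left C)
    _ = _ := by rw [tsum_mul_left, hx2.tsum_eq]; ring

/-- The bounded operator on `ℓ²` of an infinite matrix satisfying the Schur test. -/
noncomputable def op (h : SchurBound M C) : lp (fun _ : ι => ℂ) 2 →L[ℂ] lp (fun _ : ι => ℂ) 2 :=
  LinearMap.mkContinuous
    { toFun := fun x => ⟨fun i => ∑' j, M i j * x j,
        memℓp_gen' (C := (C * ‖x‖) ^ 2) fun F => by simpa using h.sum_norm_tsum_sq_le x F⟩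
      map_add' := fun x y => by
        ext i
        simp only [lp.coeFn_add, Pi.add_apply, mul_add]
        exact (h.summable_mul x i).tsum_add (h.summable_mul y i)
      map_smul' := fun c x => by
        ext i
        simp only [lp.coeFn_smul, Pi.smul_apply, smul_eq_mul, RingHom.id_apply]
        rw [← tsum_mul_left]
        exact tsum_congr fun j => by ring }
    C fun x => by
      have h0 : 0 ≤ C * ‖x‖ := by
        rcases isEmpty_or_nonempty ι with hι | hι
        · simp [lp.eq_zero' x]
        · exact mul_nonneg h.nonneg (norm_nonneg x)
      exact lp.norm_le_of_forall_sum_le (by norm_num) h0 fun F => by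
        simpa using h.sum_norm_tsum_sq_le x F

theorem op_apply (h : SchurBound M C) (x : lp (fun _ : ι => ℂ) 2) (i : ι) :
    h.op x i = ∑' j, M i j * x j := rfl

theorem norm_op_apply_le [Nonempty ι] (h : SchurBound M C) (x : lp (fun _ : ι => ℂ) 2) :
    ‖h.op x‖ ≤ C * ‖x‖ :=
  (h.op.le_opNorm x).trans (mul_le_mul_of_nonneg_right
    (LinearMap.mkContinuous_norm_le _ h.nonneg _) (norm_nonneg _))

theorem op_single [DecidableEq ι] (h : SchurBound M C) (i j : ι) (c : ℂ) :
    h.op (lp.single 2 j c) i = M i j * c := by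
  rw [op_apply, tsum_eq_single j]
  · simp
  · intro k hk
    rw [lp.single_apply_ne _ _ _ hk, mul_zero]

/-- The quadratic form of a Hermitian matrix is real. -/
theorem inner_op_self_im (h : SchurBound M C)
    (hM : ∀ i j, M j i = (starRingEnd ℂ) (M i j)) (x : lp (fun _ : ι => ℂ) 2) :
    (inner ℂ x (h.op x)).im = 0 := by
  -- By continuity it suffices to treat finite sections, where conjugation just exchanges the two
  -- summation indices.
  classical
  have hx := lp.hasSum_single (E := fun _ : ι => ℂ) (p := 2) (by norm_num) x
  have hlim : Tendsto (fun F : Finset ι => (inner ℂ (∑ i ∈ F, lp.single 2 i (x i))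
      (h.op (∑ i ∈ F, lp.single 2 i (x i)))).im) atTop (𝓝 (inner ℂ x (h.op x)).im) := by
    have hc : Continuous fun y => (inner ℂ y (h.op y)).im :=
      Complex.continuous_im.comp (continuous_id.inner h.op.continuous)
    exact (hc.tendsto x).comp hx
  refine tendsto_nhds_unique hlim (tendsto_const_nhds.congr fun F => ?_)
  symm
  have happ : ∀ i, h.op (∑ j ∈ F, lp.single 2 j (x j)) i = ∑ j ∈ F, M i j * x j := by
    intro i
    rw [map_sum, lp.coeFn_sum, Finset.sum_apply]
    exact Finset.sum_congr rfl fun j _ => h.op_single i j _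
  have hsum : inner ℂ (∑ i ∈ F, lp.single 2 i (x i)) (h.op (∑ i ∈ F, lp.single 2 i (x i))) =
      ∑ i ∈ F, ∑ j ∈ F, (starRingEnd ℂ) (x i) * (M i j * x j) := by
    rw [lp_inner_sum_single_left]
    refine Finset.sum_congr rfl fun i _ => ?_
    rw [← Finset.mul_sum]
    exact congrArg _ (happ i)
  rw [hsum, ← Complex.conj_eq_iff_im]
  simp only [map_sum, map_mul, Complex.conj_conj]
  rw [Finset.sum_comm]
  refine Finset.sum_congr rfl fun i _ => Finset.sum_congr rfl fun j _ => ?_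
  rw [hM i j, Complex.conj_conj]
  ring

end SchurBound

end Schur

/-! ### Diagonal operators and coordinate projections -/

section Multiplier

variable {ι : Type*}

-- Treating diagonals as Schur matrices lets `SchurBound.op` supply both the projections and the
-- exponential weight.
open Classical in
theorem schurBound_diagonal {m : ι → ℂ} {C : ℝ} (hC : 0 ≤ C) (hm : ∀ i, ‖m i‖ ≤ C) :
    SchurBound (fun i j => if i = j then m i else 0) C where
  row i F := by
    simp only [apply_ite norm, norm_zero, Finset.sum_ite_eq]
    split_ifs
    exacts [hm i, hC]
  col j F := by
    simp only [apply_ite norm, norm_zero, Finset.sum_ite_eq']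
    split_ifs
    exacts [hm j, hC]

theorem schurBound_diagonal_op_apply {m : ι → ℂ} {C : ℝ} (hC : 0 ≤ C) (hm : ∀ i, ‖m i‖ ≤ C)
    (x : lp (fun _ : ι => ℂ) 2) (i : ι) : (schurBound_diagonal hC hm).op x i = m i * x i := by
  rw [SchurBound.op_apply, tsum_eq_single i]
  · simp
  · intro j hj
    simp [hj.symm]

open Classical in
theorem schurBound_indicator (L : Set ι) :
    SchurBound (fun i j => if i = j then (if i ∈ L then (1 : ℂ) else 0) else 0) 1 :=
  schurBound_diagonal zero_le_one fun i => by split_ifs <;> simp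

open Classical in
/-- The orthogonal projection of `ℓ²` onto the elements supported in `L`. -/
noncomputable def lpProj (L : Set ι) : lp (fun _ : ι => ℂ) 2 →L[ℂ] lp (fun _ : ι => ℂ) 2 :=
  (schurBound_indicator L).op

theorem lpProj_apply_of_mem {L : Set ι} {i : ι} (hi : i ∈ L) (x : lp (fun _ : ι => ℂ) 2) :
    lpProj L x i = x i :=
  (schurBound_diagonal_op_apply zero_le_one (fun i => by split_ifs <;> simp) x i).trans (by simp [hi])

theorem lpProj_apply_of_notMem {L : Set ι} {i : ι} (hi : i ∉ L) (x : lp (fun _ : ι => ℂ) 2) :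
    lpProj L x i = 0 :=
  (schurBound_diagonal_op_apply zero_le_one (fun i => by split_ifs <;> simp) x i).trans (by simp [hi])

theorem norm_lpProj_apply_le [Nonempty ι] (L : Set ι) (x : lp (fun _ : ι => ℂ) 2) :
    ‖lpProj L x‖ ≤ ‖x‖ :=
   ((schurBound_indicator L).norm_op_apply_le x).trans_eq (one_mul _)

theorem lpProj_add_compl (L : Set ι) (x : lp (fun _ : ι => ℂ) 2) :
    lpProj L x + lpProj Lᶜ x = x := by
  ext i
  rw [lp.coeFn_add, Pi.add_apply]
  by_cases hi : i ∈ L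
  · rw [lpProj_apply_of_mem hi, lpProj_apply_of_notMem (by simpa), add_zero]
  · rw [lpProj_apply_of_notMem hi, lpProj_apply_of_mem hi, zero_add]

theorem lpProj_eq_self {L : Set ι} {x : lp (fun _ : ι => ℂ) 2} (hx : ∀ i, i ∉ L → x i = 0) :
    lpProj L x = x := by
  ext i
  by_cases hi : i ∈ L
  · rw [lpProj_apply_of_mem hi]
  · rw [lpProj_apply_of_notMem hi, hx i hi]

theorem lpProj_lpProj (L : Set ι) (x : lp (fun _ : ι => ℂ) 2) :
    lpProj L (lpProj L x) = lpProj L x :=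
  lpProj_eq_self fun _ hi => lpProj_apply_of_notMem hi x

theorem inner_lpProj_left (L : Set ι) (x y : lp (fun _ : ι => ℂ) 2) :
    inner ℂ (lpProj L x) y = inner ℂ x (lpProj L y) := by
  rw [lp.inner_eq_tsum, lp.inner_eq_tsum]
  refine tsum_congr fun i => ?_
  by_cases hi : i ∈ L
  · rw [lpProj_apply_of_mem hi, lpProj_apply_of_mem hi]
  · rw [lpProj_apply_of_notMem hi, lpProj_apply_of_notMem hi, inner_zero_left, inner_zero_right]

end Multiplier

/-! ### Reduction to a spectrally separated index set -/

section Reduction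

variable {ι : Type*} {a : ι → ℝ} {b : ι → ι → ℂ} {β : ℝ}

/-- The projection is self-adjoint, so this is the form of `hb.op` at `lpProj L x`. -/
theorem inner_compression_im (hb : SchurBound b β)
    (hsymm : ∀ i j, b j i = (starRingEnd ℂ) (b i j)) (L : Set ι) (x : lp (fun _ : ι => ℂ) 2) :
    (inner ℂ x ((lpProj L ∘L hb.op ∘L lpProj L) x)).im = 0 := by
  rw [ContinuousLinearMap.comp_apply, ContinuousLinearMap.comp_apply, ← inner_lpProj_left]
  exact hb.inner_op_self_im hsymm _

/-- The part of a solution outside a set `L` carrying the initial datum grows at most linearly. -/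
theorem norm_lpProj_compl_le [Nonempty ι] (hb : SchurBound b β)
    (hsymm : ∀ i j, b j i = (starRingEnd ℂ) (b i j)) (L : Set ι)
    {v : ℝ → lp (fun _ : ι => ℂ) 2} (hv : Continuous v)
    (hvder : ∀ s i, HasDerivAt (fun t => v t i)
      (Complex.I * ((a i : ℂ) * v s i + hb.op (v s) i)) s)
    (h0 : lpProj Lᶜ (v 0) = 0) {D T : ℝ} (hD : ∀ s ∈ Set.Icc 0 T, ‖v s‖ ≤ D) (hT : 0 ≤ T) :
    ‖lpProj Lᶜ (v T)‖ ≤ β * D * T := by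
  have hβ := hb.nonneg
  have hD0 : 0 ≤ D := (norm_nonneg _).trans (hD 0 ⟨le_rfl, hT⟩)
  have h := norm_le_of_schrodinger a (lpProj Lᶜ ∘L hb.op ∘L lpProj Lᶜ)
    (inner_compression_im hb hsymm Lᶜ) (v := fun s => lpProj Lᶜ (v s))
    (f := fun s => lpProj Lᶜ (hb.op (lpProj L (v s)))) ((lpProj Lᶜ).continuous.comp hv)
    (c := 0) (d := β * D) (T := T) ?_ le_rfl (by positivity) hT ?_
  · simpa [h0] using h
  · intro s i
    have hsum : (lpProj Lᶜ ∘L hb.op ∘L lpProj Lᶜ) (lpProj Lᶜ (v s)) +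
        lpProj Lᶜ (hb.op (lpProj L (v s))) = lpProj Lᶜ (hb.op (v s)) := by
      rw [ContinuousLinearMap.comp_apply, ContinuousLinearMap.comp_apply, lpProj_lpProj,
        ← map_add, ← map_add, add_comm, lpProj_add_compl]
    rw [add_assoc, ← Pi.add_apply, ← lp.coeFn_add, hsum]
    by_cases hi : i ∈ Lᶜ
    · simp only [lpProj_apply_of_mem hi]
      exact hvder s i
    · simp only [lpProj_apply_of_notMem hi]
      simpa using hasDerivAt_const s (0 : ℂ)
  · intro s hs
    rw [zero_mul, zero_add]
    calc _ ≤ β * ‖lpProj L (v s)‖ := (norm_lpProj_apply_le _ _).trans (hb.norm_op_apply_le _)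
      _ ≤ β * D := by gcongr; exact (norm_lpProj_apply_le _ _).trans (hD s hs)

/-- Propagation of a bounded weight `w` along a solution. -/
theorem norm_weight_mul_le [Nonempty ι] (hb : SchurBound b β)
    (hsymm : ∀ i j, b j i = (starRingEnd ℂ) (b i j)) {w : ι → ℝ} (hw : ∀ i, 1 ≤ w i)
    {W : lp (fun _ : ι => ℂ) 2 →L[ℂ] lp (fun _ : ι => ℂ) 2}
    (hW : ∀ x i, W x i = (w i : ℂ) * x i)
    (hconj : SchurBound (fun i j => b i j * ((w i / w j - 1 : ℝ) : ℂ)) β)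
    {v : ℝ → lp (fun _ : ι => ℂ) 2} (hv : Continuous v)
    (hvder : ∀ s i, HasDerivAt (fun t => v t i)
      (Complex.I * ((a i : ℂ) * v s i + hb.op (v s) i)) s) {T : ℝ} (hT : 0 ≤ T) :
    ‖W (v T)‖ ≤ Real.exp (β * T) * ‖W (v 0)‖ := by
  have h := norm_le_of_schrodinger a hb.op (hb.inner_op_self_im hsymm) (v := fun s => W (v s))
    (f := fun s => hconj.op (W (v s))) (W.continuous.comp hv) (c := β) (d := 0) (T := T) ?_
    hb.nonneg le_rfl hT (fun s _ => by simpa using hconj.norm_op_apply_le (W (v s)))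
  · simpa using h
  · intro s i
    simp only [hW]
    refine ((hvder s i).const_mul (w i : ℂ)).congr_deriv ?_
    -- The conjugated matrix `W B W⁻¹` is `B` plus the matrix of `hconj`; the first is harmless for
    -- the energy, the second is a bounded forcing.
    have hsum : hb.op (W (v s)) i + hconj.op (W (v s)) i = w i * hb.op (v s) i := by
      rw [SchurBound.op_apply, SchurBound.op_apply, SchurBound.op_apply, ← tsum_mul_left,
        ← (hb.summable_mul _ i).tsum_add (hconj.summable_mul _ i)]
      refine tsum_congr fun j => ?_
      have hwj : (w j : ℂ) ≠ 0 := by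
        exact_mod_cast (zero_lt_one.trans_le (hw j)).ne'
      rw [hW]
      push_cast
      field_simp
      ring
    rw [add_assoc, hsum]
    ring

/-- Comparison of a solution `v` of `v' = i (a v + B v)` in `ℓ²` with the solution `u` of the
system reduced to the index set `L`. The diagonal entries inside and outside `L` are separated by a
gap `c` on the finite set `N`, and the couplings leaving `N` are small relative to the weight `w`.
The error is quadratic in the coupling `β`. -/
theorem norm_reduction_error_le [Nonempty ι] (hb : SchurBound b β)
    (hsymm : ∀ i j, b j i = (starRingEnd ℂ) (b i j)) (L : Set ι) (N : Finset ι) {w : ι → ℝ}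
    {W : lp (fun _ : ι => ℂ) 2 →L[ℂ] lp (fun _ : ι => ℂ) 2}
    (hw : ∀ i, 1 ≤ w i) (hW : ∀ x i, W x i = (w i : ℂ) * x i)
    (hconj : SchurBound (fun i j => b i j * ((w i / w j - 1 : ℝ) : ℂ)) β) {ε c : ℝ} (hε : 0 ≤ ε)
    {r : ι → ι → ℂ} (hr : SchurBound r (ε * β))
    (hfar : ∀ i j, ¬(i ∈ N ∧ j ∈ N) → r i j * w j = b i j) (hc : 0 < c)
    (hgap : ∀ i ∈ N, i ∈ L → ∀ j ∈ N, j ∉ L → c ≤ |a i - a j|)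
    {v u : ℝ → lp (fun _ : ι => ℂ) 2} (hv : Continuous v) (hu : Continuous u)
    (hvder : ∀ s i, HasDerivAt (fun t => v t i)
      (Complex.I * ((a i : ℂ) * v s i + hb.op (v s) i)) s)
    (huder : ∀ s, ∀ i ∈ L, HasDerivAt (fun t => u t i)
      (Complex.I * ((a i : ℂ) * u s i + hb.op (u s) i)) s)
    (hu0 : ∀ s, ∀ i ∉ L, u s i = 0) (h0 : u 0 = v 0) (hW0 : W (v 0) = v 0)
    {T : ℝ} (hT : 0 ≤ T) :
    ‖lpProj L (v T) - u T‖ ≤ (3 * β ^ 2 / c + ε * β * Real.exp (β * T)) * T * ‖v 0‖ := by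
  classical
  have hβ := hb.nonneg
  have hPu : ∀ s, lpProj L (u s) = u s := fun s => lpProj_eq_self (hu0 s)
  have hQ0 : lpProj Lᶜ (v 0) = 0 := by
    have h1 := lpProj_add_compl L (v 0)
    rwa [← h0, hPu, add_eq_left, h0] at h1
  have hvn : ∀ s, 0 ≤ s → ‖v s‖ ≤ ‖v 0‖ := fun s hs => by
    simpa using norm_le_of_schrodinger a hb.op (hb.inner_op_self_im hsymm) (f := fun _ => 0) hv
      (by simpa using hvder) le_rfl le_rfl hs (by simp)
  have hQv : ‖lpProj Lᶜ (v T)‖ ≤ β * ‖v 0‖ * T :=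
    norm_lpProj_compl_le hb hsymm L hv hvder hQ0 (fun s hs => hvn s hs.1) hT
  have hWv : ∀ s ∈ Set.Icc 0 T, ‖W (v s)‖ ≤ Real.exp (β * T) * ‖v 0‖ := by
    intro s hs
    refine (norm_weight_mul_le hb hsymm hw hW hconj hv hvder hs.1).trans ?_
    rw [hW0]
    gcongr
    exact hs.2
  -- the off-diagonal correction, solving a Sylvester equation entrywise
  let x : ι → ι → ℂ := fun i j =>
    if (i ∈ L ∧ j ∉ L) ∧ (i ∈ N ∧ j ∈ N) then b i j / ((a i : ℂ) - a j) else 0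
  have hx : SchurBound x (1 / c * β) := by
    refine hb.of_norm_le (by positivity) fun i j => ?_
    by_cases h : (i ∈ L ∧ j ∉ L) ∧ (i ∈ N ∧ j ∈ N)
    · have hg := hgap i h.2.1 h.1.1 j h.2.2 h.1.2
      simp only [x, if_pos h, norm_div]
      rw [← Complex.ofReal_sub, Complex.norm_real, Real.norm_eq_abs, div_eq_mul_one_div, mul_comm]
      gcongr
    · simp only [x, if_neg h, norm_zero]
      positivity
  -- Finiteness of `N` lets `X v` be differentiated termwise from componentwise information.
  have hxsum : ∀ y i, hx.op y i = ∑ j ∈ N, x i j * y j := by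
    intro y i
    rw [SchurBound.op_apply]
    refine tsum_eq_sum fun j hj => ?_
    simp [x, hj]
  let r' : ι → ι → ℂ := fun i j =>
    if (i ∈ L ∧ j ∉ L) ∧ ¬(i ∈ N ∧ j ∈ N) then r i j else 0
  have hr' : SchurBound r' (ε * β) := by
    refine hr.mono fun i j => ?_
    simp only [r']
    split_ifs <;> simp
  -- `X` only sees the part outside `L`, which vanishes initially. Hence the boundary term `X v` is
  -- of order `β ^ 2 * T / c`, instead of merely `β / c`.
  have hxQ : ∀ y, hx.op (lpProj Lᶜ y) = hx.op y := by
    intro y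
    ext i
    rw [hxsum, hxsum]
    refine Finset.sum_congr rfl fun j _ => ?_
    by_cases hj : j ∈ Lᶜ
    · rw [lpProj_apply_of_mem hj]
    · have : x i j = 0 := if_neg fun h => hj h.1.2
      rw [this, zero_mul, zero_mul]
  -- The coupling into `L` splits into a commutator with the diagonal, on `N`, and a remainder
  -- acting on the weighted solution.
  have hsylv : ∀ y i, lpProj L (hb.op (lpProj Lᶜ y)) i =
      hr'.op (W y) i + ∑ j ∈ N, x i j * ((a i - a j) * y j) := by
    intro y i
    have hfin : ∀ j ∉ N, x i j * ((a i - a j) * y j) = 0 := fun j hj => by simp [x, hj]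
    rw [← tsum_eq_sum (L := SummationFilter.unconditional ι) hfin, SchurBound.op_apply, ← (hr'.summable_mul (W y) i).tsum_add
      (summable_of_ne_finset_zero hfin)]
    by_cases hi : i ∈ L
    · rw [lpProj_apply_of_mem hi, SchurBound.op_apply]
      refine tsum_congr fun j => ?_
      by_cases hj : j ∈ L
      · rw [lpProj_apply_of_notMem (by simpa)]
        simp [r', x, hj]
      · rw [lpProj_apply_of_mem hj, hW]
        by_cases hN : i ∈ N ∧ j ∈ N
        · have hg := hgap i hN.1 hi j hN.2 hj
          have hne : (a i : ℂ) - a j ≠ 0 := by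
            rw [← Complex.ofReal_sub, Complex.ofReal_ne_zero, ← abs_pos]
            exact hc.trans_le hg
          simp only [r', x, hi, hj, hN, not_true_eq_false, not_false_eq_true, and_self, and_false,
            if_true, if_false, zero_mul, zero_add]
          field_simp
        · simp only [r', x, hi, hj, hN, not_false_eq_true, and_self, and_false, if_true, if_false,
            zero_mul, add_zero]
          rw [← mul_assoc, hfar i j hN]
    · rw [lpProj_apply_of_notMem hi]
      symm
      simp [r', x, hi]
  -- Two terms of size `β ^ 2 / c` remain in the forcing; removing `X v` at time `T` adds the third.
  have hY := norm_le_of_schrodinger a (lpProj L ∘L hb.op ∘L lpProj L)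
    (inner_compression_im hb hsymm L)
    (v := fun s => lpProj L (v s) - u s + hx.op (v s))
    (f := fun s => hx.op (hb.op (v s)) - lpProj L (hb.op (lpProj L (hx.op (v s)))) +
      hr'.op (W (v s)))
    ((((lpProj L).continuous.comp hv).sub hu).add (hx.op.continuous.comp hv))
    (c := 0) (d := (2 * β ^ 2 / c + ε * β * Real.exp (β * T)) * ‖v 0‖) (T := T)
    ?_ le_rfl (by positivity) hT ?_
  · have hY0 : lpProj L (v 0) - u 0 + hx.op (v 0) = 0 := by
      rw [← hxQ, hQ0, map_zero, ← h0, hPu, sub_self, add_zero]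
    simp only [hY0, norm_zero, zero_add, zero_mul, Real.exp_zero, one_mul] at hY
    have hX : ‖hx.op (v T)‖ ≤ 1 / c * β * (β * ‖v 0‖ * T) := by
      rw [← hxQ]
      exact (hx.norm_op_apply_le _).trans (by gcongr)
    calc _ = ‖lpProj L (v T) - u T + hx.op (v T) - hx.op (v T)‖ := by rw [add_sub_cancel_right]
      _ ≤ _ := norm_sub_le _ _
      _ ≤ _ := add_le_add hY hX
      _ = _ := by ring
  · intro s i
    have hder1 : HasDerivAt (fun t => (lpProj L (v t) - u t) i)
        (Complex.I * ((a i : ℂ) * (lpProj L (v s) - u s) i +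
          lpProj L (hb.op (v s - u s)) i)) s := by
      simp only [lp.coeFn_sub, Pi.sub_apply]
      by_cases hi : i ∈ L
      · simp only [lpProj_apply_of_mem hi, map_sub, lp.coeFn_sub, Pi.sub_apply]
        refine ((hvder s i).sub (huder s i hi)).congr_deriv ?_
        ring
      · simp only [lpProj_apply_of_notMem hi, hu0 _ i hi]
        simpa using hasDerivAt_const s (0 : ℂ)
    have hder2 : HasDerivAt (fun t => hx.op (v t) i)
        (∑ j ∈ N, x i j * (Complex.I * ((a j : ℂ) * v s j + hb.op (v s) j))) s := by
      simp only [hxsum]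
      exact HasDerivAt.fun_sum fun j _ => (hvder s j).const_mul (x i j)
    simp only [lp.coeFn_add, Pi.add_apply]
    refine (hder1.add hder2).congr_deriv ?_
    -- Writing `a j = a i - (a i - a j)` produces the commutator that cancels the one in `hsylv`.
    have hsum2 : ∑ j ∈ N, x i j * (Complex.I * ((a j : ℂ) * v s j + hb.op (v s) j)) =
        Complex.I * (a i * hx.op (v s) i + hx.op (hb.op (v s)) i -
          ∑ j ∈ N, x i j * ((a i - a j) * v s j)) := by
      rw [hxsum, hxsum, Finset.mul_sum, ← Finset.sum_add_distrib, ← Finset.sum_sub_distrib,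
        Finset.mul_sum]
      exact Finset.sum_congr rfl fun j _ => by ring
    have hsplit : lpProj L (hb.op (v s - u s)) =
        lpProj L (hb.op (lpProj L (lpProj L (v s) - u s + hx.op (v s)))) -
          lpProj L (hb.op (lpProj L (hx.op (v s)))) + lpProj L (hb.op (lpProj Lᶜ (v s))) := by
      have hinner : v s - u s = lpProj L (lpProj L (v s) - u s) + lpProj Lᶜ (v s) := by
        rw [map_sub, lpProj_lpProj, hPu, sub_add_eq_add_sub, lpProj_add_compl]
      rw [map_add (lpProj L) (lpProj L (v s) - u s), map_add hb.op, map_add (lpProj L),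
        add_sub_cancel_right, ← map_add, ← map_add, ← hinner]
    have hsplit_i := congrArg (fun y : lp (fun _ : ι => ℂ) 2 => y i) hsplit
    simp only [lp.coeFn_add, lp.coeFn_sub, Pi.add_apply, Pi.sub_apply] at hsplit_i
    simp only [ContinuousLinearMap.comp_apply, lp.coeFn_sub, Pi.sub_apply]
    rw [hsum2, hsplit_i, hsylv]
    ring
  · intro s hs
    have hvs := hvn s hs.1
    rw [zero_mul, zero_add]
    have h1 : ‖hx.op (hb.op (v s))‖ ≤ 1 / c * β * (β * ‖v 0‖) :=
      (hx.norm_op_apply_le _).trans (by gcongr; exact (hb.norm_op_apply_le _).trans (by gcongr))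
    have h2 : ‖lpProj L (hb.op (lpProj L (hx.op (v s))))‖ ≤ β * (1 / c * β * ‖v 0‖) := by
      refine (norm_lpProj_apply_le _ _).trans ((hb.norm_op_apply_le _).trans ?_)
      gcongr
      exact (norm_lpProj_apply_le _ _).trans ((hx.norm_op_apply_le _).trans (by gcongr))
    have h3 : ‖hr'.op (W (v s))‖ ≤ ε * β * (Real.exp (β * T) * ‖v 0‖) :=
      (hr'.norm_op_apply_le _).trans (by gcongr; exact hWv s hs)
    calc _ ≤ _ := norm_add_le _ _
      _ ≤ _ := add_le_add (norm_sub_le _ _) le_rfl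
      _ ≤ _ := add_le_add (add_le_add h1 h2) h3
      _ = _ := by ring

end Reduction

/-! ### Uniform exponential sums over separated sets -/

section Packing

open MeasureTheory

/-- One Taylor term of the exponential, of degree dimension plus one, gives an integrable power
majorant. -/
theorem integrable_exp_neg_mul_norm {E : Type*} [NormedAddCommGroup E] [NormedSpace ℝ E]
    [FiniteDimensional ℝ E] [MeasurableSpace E] [BorelSpace E] (μ : Measure E) [μ.IsAddHaarMeasure]
    {β : ℝ} (hβ : 0 < β) :
    Integrable (fun x : E => Real.exp (-β * ‖x‖)) μ := by
  set m := Module.finrank ℝ E + 1 with hm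
  have h := (integrable_one_add_norm (μ := μ) (E := E) (r := (m : ℝ))
    (by rw [hm]; push_cast; linarith)).const_mul (Real.exp β * (m.factorial / β ^ m))
  refine h.mono' (by fun_prop) (Eventually.of_forall fun x => ?_)
  rw [Real.norm_of_nonneg (Real.exp_pos _).le, Real.rpow_neg (by positivity), Real.rpow_natCast]
  have h1 := Real.pow_div_factorial_le_exp (β * (1 + ‖x‖)) (by positivity) m
  have hpos : 0 < (1 + ‖x‖) ^ m := by positivity
  have h2 : Real.exp (-β * ‖x‖) = Real.exp β * (Real.exp (β * (1 + ‖x‖)))⁻¹ := by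
    rw [← Real.exp_neg, ← Real.exp_add]; congr 1; ring
  rw [h2, mul_assoc]
  refine mul_le_mul_of_nonneg_left ?_ (Real.exp_pos _).le
  calc (Real.exp (β * (1 + ‖x‖)))⁻¹ ≤ ((β * (1 + ‖x‖)) ^ m / m.factorial)⁻¹ := by
        gcongr
    _ = _ := by rw [mul_pow]; field_simp

/-- Exponential sums over separated families in a finite-dimensional space are bounded uniformly
in the family. -/
theorem exists_sum_exp_neg_norm_le (E : Type*) [NormedAddCommGroup E] [NormedSpace ℝ E]
    [FiniteDimensional ℝ E] {κ β : ℝ} (hκ : 0 < κ) (hβ : 0 < β) :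
    ∃ S : ℝ, 0 < S ∧ ∀ A : Finset E,
      (∀ x ∈ A, ∀ y ∈ A, x ≠ y → κ ≤ dist x y) → ∑ x ∈ A, Real.exp (-β * ‖x‖) ≤ S := by
  borelize E
  let μ : Measure E := Measure.addHaar
  have hint := integrable_exp_neg_mul_norm μ hβ
  set J := ∫ x, Real.exp (-β * ‖x‖) ∂μ
  have hJ : 0 ≤ J := integral_nonneg fun x => (Real.exp_pos _).le
  set V := μ.real (Metric.ball (0 : E) (κ / 2)) with hV
  have hVpos : 0 < V := ENNReal.toReal_pos (Metric.measure_ball_pos μ _ (by positivity)).ne'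
    measure_ball_lt_top.ne
  -- The balls of radius `κ / 2` are disjoint and `‖y‖` varies by at most `κ / 2` from the centre,
  -- so the sum is dominated by the integral. The summand `1` only makes the bound positive.
  refine ⟨Real.exp (β * (κ / 2)) * J / V + 1, by positivity, fun A hA => ?_⟩
  suffices h : V * ∑ x ∈ A, Real.exp (-β * ‖x‖) ≤ Real.exp (β * (κ / 2)) * J by
    rw [mul_comm, ← le_div_iff₀ hVpos] at h
    linarith
  have hball : ∀ x ∈ A, V * Real.exp (-β * ‖x‖) ≤
      Real.exp (β * (κ / 2)) * ∫ y in Metric.ball x (κ / 2), Real.exp (-β * ‖y‖) ∂μ := by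
    intro x _
    have hVx : V = μ.real (Metric.ball x (κ / 2)) := by
      rw [hV, measureReal_def, measureReal_def, Measure.addHaar_ball_center μ x]
    rw [hVx, ← smul_eq_mul, ← setIntegral_const, ← integral_const_mul]
    refine setIntegral_mono_on (integrableOn_const measure_ball_lt_top.ne)
      (hint.const_mul _).integrableOn measurableSet_ball fun y hy => ?_
    rw [← Real.exp_add, Real.exp_le_exp]
    have h1 : ‖y‖ ≤ ‖x‖ + κ / 2 := by
      have h2 := norm_le_norm_add_norm_sub' y x
      rw [Metric.mem_ball, dist_eq_norm] at hy
      linarith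
    nlinarith
  have hdisj : (A : Set E).Pairwise (Function.onFun Disjoint fun x => Metric.ball x (κ / 2)) :=
    fun x hx y hy hxy => Metric.ball_disjoint_ball (by linarith [hA x hx y hy hxy])
  calc _ ≤ ∑ x ∈ A, Real.exp (β * (κ / 2)) *
        ∫ y in Metric.ball x (κ / 2), Real.exp (-β * ‖y‖) ∂μ := by
        rw [Finset.mul_sum]; exact Finset.sum_le_sum hball
    _ = Real.exp (β * (κ / 2)) *
        ∫ y in ⋃ x ∈ A, Metric.ball x (κ / 2), Real.exp (-β * ‖y‖) ∂μ := by
        rw [← Finset.mul_sum, integral_biUnion_finset A (fun _ _ => measurableSet_ball) hdisj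
          fun _ _ => hint.integrableOn]
    _ ≤ _ := by
        refine mul_le_mul_of_nonneg_left ?_ (Real.exp_pos _).le
        exact setIntegral_le_integral hint (Eventually.of_forall fun x => (Real.exp_pos _).le)

/-- A family separated by `κ > 0` has only finitely many members in a ball. -/
theorem finite_norm_le_of_separated {E : Type*} [NormedAddCommGroup E] [NormedSpace ℝ E]
    [FiniteDimensional ℝ E] {s : Set E} {κ : ℝ} (hκ : 0 < κ)
    (hs : ∀ x ∈ s, ∀ y ∈ s, x ≠ y → κ ≤ dist x y) (R : ℝ) : {x ∈ s | ‖x‖ ≤ R}.Finite := by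
  obtain ⟨S, -, hS⟩ := exists_sum_exp_neg_norm_le E hκ one_pos
  by_contra hinf
  obtain ⟨m, hm⟩ := exists_nat_gt (S * Real.exp R)
  obtain ⟨A, hAs, hAm⟩ := Set.Infinite.exists_subset_card_eq hinf m
  have h1 := hS A fun x hx y hy => hs x (hAs hx).1 y (hAs hy).1
  have h2 : (m : ℝ) * Real.exp (-R) ≤ ∑ x ∈ A, Real.exp (-1 * ‖x‖) := by
    rw [← hAm, ← nsmul_eq_mul]
    refine Finset.card_nsmul_le_sum _ _ _ fun x hx => Real.exp_le_exp.2 ?_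
    linarith [(hAs hx).2]
  have h3 : (m : ℝ) = m * Real.exp (-R) * Real.exp R := by
    rw [mul_assoc, ← Real.exp_add]; simp
  nlinarith [Real.exp_pos R]

end Packing

namespace DHW

/-! ### Dual lattice, Ewald sphere and excitation errors -/

section Geometry

variable {n : ℕ}

theorem zero_mem_dualLattice (Λ : Submodule ℤ (Space n)) : (0 : Space n) ∈ dualLattice Λ :=
  fun _ _ => ⟨0, by simp⟩

theorem sub_mem_dualLattice {Λ : Submodule ℤ (Space n)} {g h : Space n}
    (hg : g ∈ dualLattice Λ) (hh : h ∈ dualLattice Λ) : g - h ∈ dualLattice Λ := by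
  intro r hr
  obtain ⟨a, ha⟩ := hg r hr
  obtain ⟨b, hb⟩ := hh r hr
  exact ⟨a - b, by rw [inner_sub_left, ha, hb]; push_cast; ring⟩

theorem kappaStar_le_dist {Λ : Submodule ℤ (Space n)} (hκ : 0 < kappaStar Λ) {g h : Space n}
    (hg : g ∈ dualLattice Λ) (hh : h ∈ dualLattice Λ) (hne : g ≠ h) :
    kappaStar Λ ≤ dist g h := by
  have hne0 : (dualLattice Λ).einfsep ≠ ⊤ := fun h0 => by
    rw [kappaStar, Set.infsep, h0] at hκ
    simp at hκ
  have h1 := Set.einfsep_le_edist_of_mem hg hh hne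
  rw [edist_dist] at h1
  rw [kappaStar, Set.infsep]
  exact ENNReal.toReal_le_of_le_ofReal dist_nonneg h1

theorem norm_add_sq_of_mem_tangentPlane {k₀ g : Space n} (hg : g ∈ tangentPlane k₀) :
    ‖k₀ + g‖ ^ 2 = ‖k₀‖ ^ 2 + ‖g‖ ^ 2 := by
  have h : ⟪k₀, g⟫ = 0 := by rw [real_inner_comm]; exact hg
  rw [norm_add_sq_real, h]
  ring

theorem sigma_of_mem_tangentPlane {k₀ g : Space n} (hg : g ∈ tangentPlane k₀) :
    sigma k₀ g = -‖g‖ ^ 2 := by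
  rw [sigma, norm_add_sq_of_mem_tangentPlane hg]
  ring

/-- The orthogonal projection of `g` onto the plane is a competitor at distance `|⟪g, k₀⟫| / ‖k₀‖`.
-/
theorem mul_norm_le_abs_inner {k₀ g : Space n} (hk : k₀ ≠ 0) {h₀ : ℝ}
    (hg : h₀ ≤ Metric.infDist g (tangentPlane k₀)) : h₀ * ‖k₀‖ ≤ |⟪g, k₀⟫| := by
  have hK : 0 < ‖k₀‖ := norm_pos_iff.2 hk
  have hmem : g - (⟪g, k₀⟫ / ‖k₀‖ ^ 2) • k₀ ∈ tangentPlane k₀ := by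
    change ⟪_, k₀⟫ = 0
    rw [inner_sub_left, real_inner_smul_left, real_inner_self_eq_norm_sq]
    field_simp
    ring
  have h1 := hg.trans (Metric.infDist_le_dist_of_mem hmem)
  rw [dist_eq_norm, sub_sub_cancel, norm_smul, norm_div, norm_pow, norm_norm,
    Real.norm_eq_abs] at h1
  calc h₀ * ‖k₀‖ ≤ |⟪g, k₀⟫| / ‖k₀‖ ^ 2 * ‖k₀‖ * ‖k₀‖ := by gcongr
    _ = _ := by field_simp

theorem le_abs_sigma {k₀ g : Space n} (hk : k₀ ≠ 0) {h₀ : ℝ}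
    (hg : h₀ ≤ Metric.infDist g (tangentPlane k₀)) :
    2 * h₀ * ‖k₀‖ - ‖g‖ ^ 2 ≤ |sigma k₀ g| := by
  have h1 := mul_norm_le_abs_inner hk hg
  have h2 : sigma k₀ g = -(2 * ⟪g, k₀⟫ + ‖g‖ ^ 2) := by
    rw [sigma, norm_add_sq_real, real_inner_comm]
    ring
  rw [h2, abs_neg]
  have h3 := abs_sub_abs_le_abs_sub (2 * ⟪g, k₀⟫) (-‖g‖ ^ 2)
  rw [abs_mul, abs_neg, abs_of_nonneg (sq_nonneg ‖g‖), abs_two] at h3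
  rw [neg_eq_neg_one_mul, neg_one_mul, sub_neg_eq_add] at h3
  linarith

/-- The competitor is the radial projection of `k₀ + g`, at distance `‖k₀ + g‖ - ‖k₀‖`. The bound
puts every tangent lattice point of the paraxial ball into the LOLZ. -/
theorem infDist_ewaldSphere_le {k₀ g : Space n} (hk : k₀ ≠ 0) (hg : g ∈ tangentPlane k₀) :
    Metric.infDist g (ewaldSphere k₀) ≤ ‖g‖ ^ 2 / (2 * ‖k₀‖) := by
  have hK : 0 < ‖k₀‖ := norm_pos_iff.2 hk
  have hsq := norm_add_sq_of_mem_tangentPlane hg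
  have hle : ‖k₀‖ ≤ ‖k₀ + g‖ :=
    (pow_le_pow_iff_left₀ (norm_nonneg _) (norm_nonneg _) two_ne_zero).1
      (by nlinarith [sq_nonneg ‖g‖])
  have hpos : 0 < ‖k₀ + g‖ := hK.trans_le hle
  have hmem : (‖k₀‖ / ‖k₀ + g‖) • (k₀ + g) - k₀ ∈ ewaldSphere k₀ := by
    change ‖k₀‖ ^ 2 - _ = 0
    rw [add_sub_cancel, norm_smul, norm_div, norm_norm, norm_norm, div_mul_cancel₀ _ hpos.ne',
      sub_self]
  refine (Metric.infDist_le_dist_of_mem hmem).trans ?_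
  have h1 : g - ((‖k₀‖ / ‖k₀ + g‖) • (k₀ + g) - k₀) =
      (1 - ‖k₀‖ / ‖k₀ + g‖) • (k₀ + g) := by
    rw [sub_smul, one_smul]; abel
  have h2 : 0 ≤ 1 - ‖k₀‖ / ‖k₀ + g‖ := by rw [sub_nonneg, div_le_one hpos]; exact hle
  have h3 : (1 - ‖k₀‖ / ‖k₀ + g‖) * ‖k₀ + g‖ = ‖k₀ + g‖ - ‖k₀‖ := by field_simp
  rw [dist_eq_norm, h1, norm_smul, Real.norm_of_nonneg h2, h3, le_div_iff₀ (by positivity)]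
  nlinarith

/-- By the triangle inequality the distance to the sphere is at least `‖k₀ + g‖ - ‖k₀‖`; Pythagoras
then bounds `‖g‖`. -/
theorem norm_sq_le_of_mem_gLOLZ {Λ : Submodule ℤ (Space n)} {k₀ g : Space n}
    (hg : g ∈ gLOLZ Λ k₀) : ‖g‖ ^ 2 ≤ kappaStar Λ * ‖k₀‖ + kappaStar Λ ^ 2 / 4 := by
  have hne : (ewaldSphere k₀).Nonempty := ⟨0, by simp [ewaldSphere, sigma]⟩
  have h1 : ‖k₀ + g‖ - ‖k₀‖ ≤ Metric.infDist g (ewaldSphere k₀) := by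
    refine (Metric.le_infDist hne).2 fun y hy => ?_
    have hy' : ‖k₀ + y‖ = ‖k₀‖ :=
      (pow_left_inj₀ (norm_nonneg _) (norm_nonneg _) two_ne_zero).1 (sub_eq_zero.1 hy).symm
    rw [← hy', dist_eq_norm, ← add_sub_add_left_eq_sub g y k₀]
    exact norm_sub_norm_le _ _
  have h2 := h1.trans hg.2.2
  have h3 := norm_add_sq_of_mem_tangentPlane hg.2.1
  nlinarith [norm_nonneg (k₀ + g), norm_nonneg k₀]

theorem rho_eq_add (k₀ g : Space n) : rho k₀ g = ⟪k₀, nu n⟫ + ⟪g, nu n⟫ := inner_add_left _ _ _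

theorem rho_zero (k₀ : Space n) : rho k₀ 0 = ⟪k₀, nu n⟫ := by simp [rho]

theorem norm_nu : ‖nu n‖ = 1 := by simp [nu]

theorem abs_inner_nu_le (g : Space n) : |⟪g, nu n⟫| ≤ ‖g‖ := by
  simpa [norm_nu] using abs_real_inner_le_norm g (nu n)

theorem rho_le (k₀ g : Space n) : rho k₀ g ≤ ‖k₀‖ + ‖g‖ := by
  rw [rho_eq_add]
  exact add_le_add ((le_abs_self _).trans (abs_inner_nu_le _))
    ((le_abs_self _).trans (abs_inner_nu_le _))

/-- The lowest-order Laue zone consists of forward beams when `|k₀|` is large. -/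
theorem gLOLZ_subset_gGamma {Λ : Submodule ℤ (Space n)} {k₀ : Space n} {c₀ : ℝ} (hc₀ : 0 < c₀)
    (hk : c₀ * ‖k₀‖ ≤ ⟪k₀, nu n⟫) (hκ : 0 < kappaStar Λ) (hK : kappaStar Λ ≤ ‖k₀‖)
    (hK' : 8 * kappaStar Λ ≤ c₀ ^ 2 * ‖k₀‖) : gLOLZ Λ k₀ ⊆ gGamma Λ k₀ (1 / 2) := by
  intro g hg
  refine ⟨hg.1, ?_⟩
  have h1 := norm_sq_le_of_mem_gLOLZ hg
  have h2 : ‖g‖ ≤ c₀ * ‖k₀‖ / 2 := by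
    refine (pow_le_pow_iff_left₀ (norm_nonneg _) (by positivity) two_ne_zero).1 (h1.trans ?_)
    nlinarith [norm_nonneg k₀, mul_le_mul_of_nonneg_left hK hκ.le,
      mul_le_mul_of_nonneg_right hK' (norm_nonneg k₀)]
  have h3 := (abs_le.1 ((abs_inner_nu_le g).trans h2)).1
  rw [rho_zero, rho_eq_add]
  linarith

/-- The excitation errors divided by `ρ` inside and outside the tangent plane are separated. -/
theorem gap_le_abs_sub {k₀ g h : Space n} {c₀ h₀ μ : ℝ} (hc₀ : 0 < c₀) (hh₀ : 0 < h₀) (hμ : 0 < μ)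
    (hμc : 8 * μ ≤ c₀ * h₀) (hμh : μ ≤ h₀) (hμK : μ ≤ ‖k₀‖) (hk : k₀ ≠ 0)
    (hρg : c₀ * ‖k₀‖ / 2 ≤ rho k₀ g) (hρh : c₀ * ‖k₀‖ / 2 ≤ rho k₀ h)
    (hg : g ∈ tangentPlane k₀) (hgn : ‖g‖ ^ 2 ≤ μ * ‖k₀‖)
    (hh : h₀ ≤ Metric.infDist h (tangentPlane k₀)) (hhn : ‖h‖ ^ 2 ≤ μ * ‖k₀‖) :
    Real.pi * h₀ / 4 ≤
      |Real.pi * sigma k₀ g / rho k₀ g - Real.pi * sigma k₀ h / rho k₀ h| := by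
  have hK : 0 < ‖k₀‖ := norm_pos_iff.2 hk
  have hρg0 : 0 < rho k₀ g := lt_of_lt_of_le (by positivity) hρg
  have hρh0 : 0 < rho k₀ h := lt_of_lt_of_le (by positivity) hρh
  -- In the plane `|σ| ≤ μ‖k₀‖` and `ρ ≥ c₀‖k₀‖/2`, so the quotient is at most `2μ/c₀`.
  have h1 : |sigma k₀ g / rho k₀ g| ≤ h₀ / 4 := by
    rw [sigma_of_mem_tangentPlane hg, abs_div, abs_neg, abs_of_nonneg (sq_nonneg _),
      abs_of_pos hρg0, div_le_iff₀ hρg0]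
    nlinarith
  have hhK : ‖h‖ ≤ ‖k₀‖ :=
    (pow_le_pow_iff_left₀ (norm_nonneg _) hK.le two_ne_zero).1 (hhn.trans (by nlinarith))
  -- Off the plane `|σ| ≥ (2h₀ - μ)‖k₀‖ ≥ h₀‖k₀‖`, while `ρ ≤ 2‖k₀‖`.
  have h2 : h₀ / 2 ≤ |sigma k₀ h / rho k₀ h| := by
    have h3 := le_abs_sigma hk hh
    have h4 := rho_le k₀ h
    rw [abs_div, abs_of_pos hρh0, le_div_iff₀ hρh0]
    nlinarith [mul_le_mul_of_nonneg_right hμh hK.le]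
  have h5 := abs_sub_abs_le_abs_sub (sigma k₀ h / rho k₀ h) (sigma k₀ g / rho k₀ g)
  rw [mul_div_assoc, mul_div_assoc, mul_div_assoc, ← mul_sub, abs_mul, abs_of_pos Real.pi_pos,
    abs_sub_comm]
  exact mul_le_mul_of_nonneg_left (by linarith) Real.pi_pos.le

end Geometry

/-- The exponential gain on the scale `|k₀|^{1/2}` beats the growth on the scale `|k₀|^{1/3}`. -/
theorem exists_forall_mul_exp_le {p s β μ : ℝ} (hs : 0 < s) (hβ : 0 < β)
    (hμ : 0 < μ) :
    ∃ k₁ : ℝ, 0 < k₁ ∧ ∀ K ≥ k₁, p * (s * K) ^ (1 / 3 : ℝ) *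
      Real.exp (p * (s * K) ^ (1 / 3 : ℝ) - β * √(μ * K)) ≤ 1 / (s * K) ^ 2 := by
  have h1 : Tendsto (fun K : ℝ => K ^ (1 / 6 : ℝ)) atTop atTop :=
    tendsto_rpow_atTop (by norm_num)
  have h2 : Tendsto (fun K : ℝ => √(μ * K)) atTop atTop :=
    Real.tendsto_sqrt_atTop.comp (tendsto_id.const_mul_atTop hμ)
  -- With `x = √(μ * K)`, the power five is one from the prefactor and four from `K ^ 2 = x ^ 4 / μ
  -- ^ 2`. Half of the decay rate absorbs the cube-root growth.
  have h3 := ((tendsto_rpow_mul_exp_neg_mul_atTop_nhds_zero 5 (β / 2) (by positivity)).comp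
    h2).const_mul (s ^ 2 / μ ^ 2 * (β / 2))
  rw [mul_zero] at h3
  have e1 := h1.eventually_ge_atTop (p * s ^ (1 / 3 : ℝ) / (β / 2 * √μ))
  have e3 := h3.eventually (ge_mem_nhds one_pos)
  obtain ⟨k₁, hk₁⟩ := eventually_atTop.1 (e1.and e3)
  refine ⟨max k₁ 1, by positivity, fun K hK => ?_⟩
  obtain ⟨g1, g3⟩ := hk₁ K ((le_max_left _ _).trans hK)
  have hK0 : 0 < K := lt_of_lt_of_le one_pos ((le_max_right _ _).trans hK)
  have hsq : √(μ * K) = √μ * K ^ (1 / 6 : ℝ) * K ^ (1 / 3 : ℝ) := by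
    rw [Real.sqrt_mul hμ.le, mul_assoc, ← Real.rpow_add hK0, Real.sqrt_eq_rpow K]
    norm_num
  have hle : p * (s * K) ^ (1 / 3 : ℝ) ≤ β / 2 * √(μ * K) := by
    rw [div_le_iff₀ (by positivity)] at g1
    rw [Real.mul_rpow hs.le hK0.le, hsq]
    nlinarith [Real.rpow_pos_of_pos hK0 (1 / 3)]
  set x := √(μ * K) with hx
  have hx0 : 0 < x := Real.sqrt_pos.2 (by positivity)
  have hx2 : x ^ 2 = μ * K := Real.sq_sqrt (by positivity)
  have hKx : K = x ^ 2 / μ := by rw [hx2]; field_simp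
  simp only [Function.comp_apply] at g3
  rw [← hx, show (5 : ℝ) = ((5 : ℕ) : ℝ) by norm_num, Real.rpow_natCast] at g3
  calc _ ≤ β / 2 * x * Real.exp (-(β / 2) * x) := by
        gcongr
        linarith
    _ = (s ^ 2 / μ ^ 2 * (β / 2) * (x ^ 5 * Real.exp (-(β / 2) * x))) / (s * K) ^ 2 := by
        rw [hKx]
        field_simp
    _ ≤ _ := by gcongr

end DHW

namespace DHW

/-! ### Symmetrized system in `ℓ²` -/

section Reformulation

variable {n : ℕ} {k₀ : Space n} {U : Space n → ℂ} {G G' : Set (Space n)}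

theorem hasSum_subtype_of_subset {f : Space n → ℝ} (hG : G' ⊆ G)
    (hf : Summable fun g : G' => f g) :
    HasSum (fun i : G => G'.indicator f i) (∑' g : G', f g) := by
  have h1 : HasSum (G'.indicator f) (∑' g : G', f g) := hasSum_subtype_iff_indicator.1 hf.hasSum
  exact (hasSum_subtype_iff_of_support_subset
    ((Set.support_indicator_subset).trans hG)).2 h1

/-- The weighted family `(ρ_g^{1/2} φ_g)_{g ∈ G}`. -/
noncomputable def weighted (k₀ : Space n) (G : Set (Space n)) (φ : Space n → ℂ) : G → ℂ :=
  fun i => (√(rho k₀ i) : ℂ) * φ i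

theorem norm_weighted_sq (hρ : ∀ g ∈ G, 0 < rho k₀ g) (φ : Space n → ℂ) (i : G) :
    ‖weighted k₀ G φ i‖ ^ 2 = rho k₀ i * ‖φ i‖ ^ 2 := by
  rw [weighted, norm_mul, mul_pow, Complex.norm_real, Real.norm_of_nonneg (Real.sqrt_nonneg _),
    Real.sq_sqrt (hρ i i.2).le]

theorem memℓp_weighted (hρ : ∀ g ∈ G, 0 < rho k₀ g) (hG : G' ⊆ G) {φ : Space n → ℂ}
    (hφ : ∀ g, g ∉ G' → φ g = 0) (hmem : MemH k₀ G' φ) : Memℓp (weighted k₀ G φ) 2 := by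
  refine memℓp_gen ?_
  simp only [ENNReal.toReal_ofNat, Real.rpow_ofNat, norm_weighted_sq hρ]
  refine (hasSum_subtype_of_subset (f := fun g => rho k₀ g * ‖φ g‖ ^ 2) hG
    hmem.2).summable.congr fun i => ?_
  by_cases hi : (i : Space n) ∈ G'
  · rw [Set.indicator_of_mem hi]
  · rw [Set.indicator_of_notMem hi, hφ i hi]
    simp

theorem norm_eq_normG (hρ : ∀ g ∈ G, 0 < rho k₀ g) (hG : G' ⊆ G) {φ : Space n → ℂ}
    {x : lp (fun _ : G => ℂ) 2} (hx : ∀ i : G, (i : Space n) ∈ G' → x i = weighted k₀ G φ i)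
    (hx0 : ∀ i : G, (i : Space n) ∉ G' → x i = 0) : ‖x‖ = normG k₀ G' φ := by
  have hsq : ∀ i : G, ‖x i‖ ^ 2 = G'.indicator (fun g => rho k₀ g * ‖φ g‖ ^ 2) i := by
    intro i
    by_cases hi : (i : Space n) ∈ G'
    · rw [Set.indicator_of_mem hi, hx i hi, norm_weighted_sq hρ]
    · rw [Set.indicator_of_notMem hi, hx0 i hi]
      simp
  have h1 : HasSum (fun i : G => ‖x i‖ ^ 2) (‖x‖ ^ 2) := by
    simpa using lp.hasSum_norm (E := fun _ : G => ℂ) (p := 2) (by norm_num) x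
  simp only [hsq] at h1
  have h2 : HasSum (G'.indicator fun g => rho k₀ g * ‖φ g‖ ^ 2) (‖x‖ ^ 2) :=
    (hasSum_subtype_iff_of_support_subset ((Set.support_indicator_subset).trans hG)).1 h1
  have h3 := (hasSum_subtype_iff_indicator.2 h2).tsum_eq
  rw [normG, ← Real.sqrt_sq (norm_nonneg x), ← h3]
  rfl

/-- The matrix `π U_{g-h} / (ρ_g ρ_h)^{1/2}` of the symmetrized scattering operator. -/
noncomputable def couplingMatrix (k₀ : Space n) (U : Space n → ℂ) (G : Set (Space n)) (i j : G) : ℂ :=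
  Real.pi * U (i - j) / (√(rho k₀ i) * √(rho k₀ j))

/-- A solution on the beam set `G'`, as a curve in `ℓ²(G)` for a larger beam set `G`. -/
noncomputable def IsSolution.curve {ψ : ℝ → Space n → ℂ} (hψ : IsSolution k₀ U G' ψ)
    (hρ : ∀ g ∈ G, 0 < rho k₀ g) (hG : G' ⊆ G) (s : ℝ) : lp (fun _ : G => ℂ) 2 :=
  ⟨weighted k₀ G (ψ s), memℓp_weighted hρ hG (hψ.eq_zero_outside s) (hψ.memH s)⟩

namespace IsSolution

variable {ψ : ℝ → Space n → ℂ}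

theorem curve_apply (hψ : IsSolution k₀ U G' ψ) (hρ : ∀ g ∈ G, 0 < rho k₀ g) (hG : G' ⊆ G)
    (s : ℝ) (i : G) : hψ.curve hρ hG s i = √(rho k₀ i) * ψ s i := rfl

theorem curve_apply_of_notMem (hψ : IsSolution k₀ U G' ψ) (hρ : ∀ g ∈ G, 0 < rho k₀ g)
    (hG : G' ⊆ G) (s : ℝ) {i : G} (hi : (i : Space n) ∉ G') : hψ.curve hρ hG s i = 0 := by
  rw [curve_apply, hψ.eq_zero_outside s i hi, mul_zero]

theorem continuous_curve (hψ : IsSolution k₀ U G' ψ) (hρ : ∀ g ∈ G, 0 < rho k₀ g)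
    (hG : G' ⊆ G) : Continuous (hψ.curve hρ hG) := by
  refine continuous_iff_continuousAt.2 fun s₀ => tendsto_iff_norm_sub_tendsto_zero.2 ?_
  refine (hψ.continuous s₀).congr fun s => (norm_eq_normG hρ hG ?_ ?_).symm
  · intro i _
    rw [lp.coeFn_sub, Pi.sub_apply, curve_apply, curve_apply, weighted, mul_sub]
  · intro i hi
    rw [lp.coeFn_sub, Pi.sub_apply, curve_apply_of_notMem _ _ _ _ hi,
      curve_apply_of_notMem _ _ _ _ hi, sub_zero]

/-- Extension by zero lets the operator of the large set `G` serve the reduced system too, on the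
components in `G'`. -/
theorem hasDerivAt_curve (hψ : IsSolution k₀ U G' ψ) (hρ : ∀ g ∈ G, 0 < rho k₀ g) (hG : G' ⊆ G)
    {C : ℝ} (hb : SchurBound (couplingMatrix k₀ U G) C) (s : ℝ) (i : G)
    (hi : (i : Space n) ∈ G') :
    HasDerivAt (fun t => hψ.curve hρ hG t i)
      (Complex.I * (((Real.pi * sigma k₀ i / rho k₀ i : ℝ) : ℂ) * hψ.curve hρ hG s i +
        hb.op (hψ.curve hρ hG s) i)) s := by
  have hder := ((hψ.differentiable i hi s).hasDerivAt).const_mul (√(rho k₀ i) : ℂ)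
  refine hder.congr_deriv ?_
  have hri : (√(rho k₀ i) : ℂ) ≠ 0 := by
    exact_mod_cast (Real.sqrt_pos.2 (hρ i i.2)).ne'
  have hri2 : (rho k₀ i : ℂ) = (√(rho k₀ i) : ℂ) ^ 2 := by
    exact_mod_cast (Real.sq_sqrt (hρ i i.2).le).symm
  have hpi : (Real.pi : ℂ) ≠ 0 := by exact_mod_cast Real.pi_ne_zero
  have hop : hb.op (hψ.curve hρ hG s) i =
      Real.pi / √(rho k₀ i) * ∑' h : G', U (i - h) * ψ s h := by
    have h1 : ∑' h : G', U (i - h) * ψ s h = ∑' j : G, U (i - j) * ψ s j := by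
      have hsupp : Function.support (fun h => U (i - h) * ψ s h) ⊆ G' := fun h hh => by
        by_contra hne
        exact hh (by simp [hψ.eq_zero_outside s h hne])
      rw [tsum_subtype_eq_of_support_subset hsupp,
        tsum_subtype_eq_of_support_subset (hsupp.trans hG)]
    rw [h1, ← tsum_mul_left, SchurBound.op_apply]
    refine tsum_congr fun j => ?_
    have hrj : (√(rho k₀ j) : ℂ) ≠ 0 := by
      exact_mod_cast (Real.sqrt_pos.2 (hρ j j.2)).ne'
    rw [couplingMatrix, curve_apply]
    field_simp
  have heq := hψ.equation s i hi
  have hder_eq : deriv (fun t => ψ t i) s = Real.pi / rho k₀ i * (Complex.I *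
      ((sigma k₀ i : ℂ) * ψ s i + ∑' h : G', U (i - h) * ψ s h)) := by
    rw [← heq]
    push_cast
    rw [hri2]
    field_simp
  rw [hder_eq, hop, curve_apply]
  push_cast
  rw [hri2]
  field_simp

end IsSolution

end Reformulation

/-! ### Decay of the coupling matrix and exponential weights -/

section Coupling

variable {n : ℕ} {k₀ : Space n} {U : Space n → ℂ} {Λ : Submodule ℤ (Space n)}

/-- Matrices with exponential off-diagonal decay on a beam set satisfy the Schur test. -/
theorem schurBound_of_exp_decay {G : Set (Space n)} (hG : G ⊆ dualLattice Λ)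
    (hκ : 0 < kappaStar Λ) {β S r : ℝ}
    (hS : ∀ A : Finset (Space n), (∀ x ∈ A, ∀ y ∈ A, x ≠ y → kappaStar Λ ≤ dist x y) →
      ∑ x ∈ A, Real.exp (-β * ‖x‖) ≤ S) (hr : 0 ≤ r) {M : G → G → ℂ}
    (hM : ∀ i j : G, ‖M i j‖ ≤ r * Real.exp (-β * ‖(i : Space n) - j‖)) :
    SchurBound M (r * S) := by
  classical
  have key : ∀ (i : G) (F : Finset G), ∑ j ∈ F, Real.exp (-β * ‖(i : Space n) - j‖) ≤ S := by
    intro i F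
    have hinj : Set.InjOn (fun j : G => (i : Space n) - j) F := fun x _ y _ hxy =>
      Subtype.ext (sub_right_injective hxy)
    rw [← Finset.sum_image (f := fun x : Space n => Real.exp (-β * ‖x‖)) hinj]
    refine hS _ fun x hx y hy hxy => ?_
    obtain ⟨a, -, rfl⟩ := Finset.mem_image.1 hx
    obtain ⟨b, -, rfl⟩ := Finset.mem_image.1 hy
    exact kappaStar_le_dist hκ (sub_mem_dualLattice (hG i.2) (hG a.2))
      (sub_mem_dualLattice (hG i.2) (hG b.2)) hxy
  refine ⟨fun i F => ?_, fun j F => ?_⟩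
  · refine (Finset.sum_le_sum fun j _ => hM i j).trans ?_
    rw [← Finset.mul_sum]
    exact mul_le_mul_of_nonneg_left (key i F) hr
  · refine (Finset.sum_le_sum fun i _ => hM i j).trans ?_
    simp only [norm_sub_rev _ (j : Space n)]
    rw [← Finset.mul_sum]
    exact mul_le_mul_of_nonneg_left (key j F) hr

theorem couplingMatrix_conj {G : Set (Space n)} (hG : G ⊆ dualLattice Λ)
    (hU : ∀ g ∈ dualLattice Λ, U (-g) = (starRingEnd ℂ) (U g)) (i j : G) :
    couplingMatrix k₀ U G j i = (starRingEnd ℂ) (couplingMatrix k₀ U G i j) := by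
  have h := hU _ (sub_mem_dualLattice (hG i.2) (hG j.2))
  rw [neg_sub] at h
  simp only [couplingMatrix, h, map_div₀, map_mul, Complex.conj_ofReal]
  ring

theorem norm_couplingMatrix_le {G : Set (Space n)} (hG : G ⊆ dualLattice Λ) {CU α ρ₀ : ℝ}
    (hρ₀ : 0 < ρ₀) (hρ : ∀ g ∈ G, ρ₀ ≤ rho k₀ g)
    (hU : ∀ g ∈ dualLattice Λ, ‖U g‖ ≤ CU * Real.exp (-α * ‖g‖)) (i j : G) :
    ‖couplingMatrix k₀ U G i j‖ ≤
      Real.pi * CU / ρ₀ * Real.exp (-α * ‖(i : Space n) - j‖) := by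
  have h := hU _ (sub_mem_dualLattice (hG i.2) (hG j.2))
  have hij : ρ₀ ≤ √(rho k₀ i) * √(rho k₀ j) := by
    rw [← Real.mul_self_sqrt hρ₀.le]
    gcongr
    exacts [hρ i i.2, hρ j j.2]
  rw [couplingMatrix, norm_div, norm_mul, ← Complex.ofReal_mul, Complex.norm_real,
    Complex.norm_real, Real.norm_of_nonneg Real.pi_pos.le, Real.norm_of_nonneg (by positivity)]
  calc _ ≤ Real.pi * (CU * Real.exp (-α * ‖(i : Space n) - j‖)) / ρ₀ := by
        have := (norm_nonneg _).trans h
        gcongr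
    _ = _ := by ring

/-- The truncated exponential weight `exp (β min(|g|, M))`. -/
noncomputable def expWeight (β M : ℝ) (g : Space n) : ℝ := Real.exp (β * min ‖g‖ M)

theorem one_le_expWeight {β M : ℝ} (hβ : 0 ≤ β) (hM : 0 ≤ M) (g : Space n) :
    1 ≤ expWeight β M g :=
  Real.one_le_exp (mul_nonneg hβ (le_min (norm_nonneg g) hM))

theorem expWeight_le {β M : ℝ} (hβ : 0 ≤ β) (g : Space n) : expWeight β M g ≤ Real.exp (β * M) :=
  Real.exp_le_exp.2 (mul_le_mul_of_nonneg_left (min_le_right _ _) hβ)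

/-- The truncated norm is 1-Lipschitz, so the ratio lies between `0` and an exponential that is at
least `1`. -/
theorem abs_expWeight_div_sub_one_le {β M : ℝ} (hβ : 0 ≤ β) (g h : Space n) :
    |expWeight β M g / expWeight β M h - 1| ≤ Real.exp (β * ‖g - h‖) := by
  have h1 : expWeight β M g / expWeight β M h ≤ Real.exp (β * ‖g - h‖) := by
    rw [expWeight, expWeight, ← Real.exp_sub, Real.exp_le_exp, ← mul_sub]
    refine mul_le_mul_of_nonneg_left ?_ hβ
    have h2 := norm_le_norm_add_norm_sub' g h
    have h3 := norm_nonneg (g - h)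
    rcases min_cases ‖h‖ M with h4 | h4 <;> rcases min_cases ‖g‖ M with h5 | h5 <;> linarith
  have h2 : 0 < expWeight β M g / expWeight β M h := div_pos (Real.exp_pos _) (Real.exp_pos _)
  have h3 : 1 ≤ Real.exp (β * ‖g - h‖) := Real.one_le_exp (by positivity)
  rw [abs_le]
  constructor <;> linarith

/-- If `‖h‖ ≥ M`, the weight alone gives the factor; otherwise `‖g‖ > M`, and the jump from `h` to
`g` supplies the missing length. -/
theorem exp_div_expWeight_le {β M : ℝ} (hβ : 0 ≤ β) {g h : Space n}
    (hfar : ¬(‖g‖ ≤ M ∧ ‖h‖ ≤ M)) :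
    Real.exp (-β * ‖g - h‖) / expWeight β M h ≤ Real.exp (-(β * M)) := by
  rw [expWeight, ← Real.exp_sub, Real.exp_le_exp]
  have h2 := norm_le_norm_add_norm_sub' g h
  have h3 := norm_nonneg (g - h)
  have h4 : M ≤ ‖g - h‖ + min ‖h‖ M := by
    rcases min_cases ‖h‖ M with h4 | h4
    · by_cases hg : ‖g‖ ≤ M
      · exact absurd ⟨hg, by linarith⟩ hfar
      · linarith
    · linarith
  nlinarith [mul_le_mul_of_nonneg_left h4 hβ]

end Coupling

end DHW

/-! ### Assembly of the LOLZ estimate -/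

namespace DHW

theorem delta_mul_expWeight {n : ℕ} (β M : ℝ) (hM : 0 ≤ M) (g : Space n) :
    (expWeight β M g : ℂ) * delta n g = delta n g := by
  by_cases hg : g = 0
  · simp [hg, expWeight, hM]
  · simp [delta, hg]

/-- The LOLZ error with constants independent of the crystal and of the wave vector: `S` bounds
exponential sums over the dual lattice and `μ` is the width of the paraxial region `|g|² ≤ μ |k₀|`
in which the excitation errors are separated. -/
theorem normG_gLOLZ_sub_le {n : ℕ} {Λ : Submodule ℤ (Space n)} {k₀ : Space n}
    {αU h₀ c₀ μ S : ℝ} (hαU : 0 < αU) (hh₀ : 0 < h₀) (hc₀ : 0 < c₀) (hμ : 0 < μ) (hk : k₀ ≠ 0)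
    (hκ : 0 < kappaStar Λ) (hkν : c₀ * ‖k₀‖ ≤ ⟪k₀, nu n⟫)
    (hlayer : ∀ g ∈ dualLattice Λ, g ∉ tangentPlane k₀ →
      h₀ ≤ Metric.infDist g (tangentPlane k₀))
    (hS : ∀ A : Finset (Space n), (∀ x ∈ A, ∀ y ∈ A, x ≠ y → kappaStar Λ ≤ dist x y) →
      ∑ x ∈ A, Real.exp (-(αU / 2) * ‖x‖) ≤ S)
    (hμc : 8 * μ ≤ c₀ * h₀) (hμh : μ ≤ h₀) (hμκ : μ ≤ kappaStar Λ) (hμK : μ ≤ ‖k₀‖)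
    (hsub : gLOLZ Λ k₀ ⊆ gGamma Λ k₀ (1 / 2))
    {CU : ℝ} {U : Space n → ℂ} (hCU : 0 < CU)
    (hU : ∀ g ∈ dualLattice Λ, U (-g) = (starRingEnd ℂ) (U g))
    (hUb : ∀ g ∈ dualLattice Λ, ‖U g‖ ≤ CU * Real.exp (-αU * ‖g‖))
    {ψγ ψL : ℝ → Space n → ℂ} (hγ : IsSolution k₀ U (gGamma Λ k₀ (1 / 2)) ψγ)
    (hL : IsSolution k₀ U (gLOLZ Λ k₀) ψL) {β : ℝ} (hβ : β = 2 * Real.pi * S / c₀ * (CU / ‖k₀‖))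
    {z : ℝ} (hz : 0 ≤ z) :
    normG k₀ (gLOLZ Λ k₀) (fun g => ψL z g - ψγ z g) ≤
      (3 * β ^ 2 / (Real.pi * h₀ / 4) +
        Real.exp (-(αU / 2 * √(μ * ‖k₀‖))) * β * Real.exp (β * z)) * z *
        normG k₀ (gGamma Λ k₀ (1 / 2)) (delta n) := by
  classical
  have hK : 0 < ‖k₀‖ := norm_pos_iff.2 hk
  set G := gGamma Λ k₀ (1 / 2)
  set M := √(μ * ‖k₀‖) with hM
  have hM0 : 0 ≤ M := Real.sqrt_nonneg _
  have hM2 : M ^ 2 = μ * ‖k₀‖ := Real.sq_sqrt (by positivity)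
  have hα2 : 0 ≤ αU / 2 := by positivity
  have hGd : G ⊆ dualLattice Λ := fun g hg => hg.1
  have hρ₀ : 0 < c₀ * ‖k₀‖ / 2 := by positivity
  have hρ : ∀ g ∈ G, c₀ * ‖k₀‖ / 2 ≤ rho k₀ g := fun g hg => by
    have h1 := hg.2
    rw [rho_zero] at h1
    linarith
  have hρpos : ∀ g ∈ G, 0 < rho k₀ g := fun g hg => hρ₀.trans_le (hρ g hg)
  have h0L : (0 : Space n) ∈ gLOLZ Λ k₀ := by
    refine ⟨zero_mem_dualLattice Λ, by simp [tangentPlane], ?_⟩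
    rw [Metric.infDist_zero_of_mem (by simp [ewaldSphere, sigma])]
    positivity
  have : Nonempty G := ⟨⟨0, hsub h0L⟩⟩
  set r := Real.pi * CU / (c₀ * ‖k₀‖ / 2) with hr
  have hr0 : 0 ≤ r := by positivity
  have hrS : r * S = β := by rw [hβ, hr]; field_simp
  -- Half of the decay rate pays for the Schur sums, the other half for the exponential weight.
  have hsplit : ∀ i j : G, Real.exp (-αU * ‖(i : Space n) - j‖) =
      Real.exp (-(αU / 2) * ‖(i : Space n) - j‖) *
        Real.exp (-(αU / 2) * ‖(i : Space n) - j‖) := fun i j => by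
    rw [← Real.exp_add]; congr 1; ring
  have hbnorm : ∀ i j : G, ‖couplingMatrix k₀ U G i j‖ ≤ r *
      (Real.exp (-(αU / 2) * ‖(i : Space n) - j‖) *
        Real.exp (-(αU / 2) * ‖(i : Space n) - j‖)) := fun i j => by
    rw [← hsplit]; exact norm_couplingMatrix_le hGd hρ₀ hρ hUb i j
  have hexp1 : ∀ i j : G, Real.exp (-(αU / 2) * ‖(i : Space n) - j‖) ≤ 1 := fun i j =>
    Real.exp_le_one_iff.2 (by nlinarith [norm_nonneg ((i : Space n) - j)])
  have hb : SchurBound (couplingMatrix k₀ U G) β := by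
    rw [← hrS]
    refine schurBound_of_exp_decay hGd hκ hS hr0 fun i j => (hbnorm i j).trans ?_
    exact mul_le_mul_of_nonneg_left
      (mul_le_of_le_one_right (Real.exp_pos _).le (hexp1 i j)) hr0
  -- The truncation at `M` makes the weight a bounded operator; its value `1` at the origin leaves
  -- the initial beam unchanged.
  let w : G → ℝ := fun i => expWeight (αU / 2) M (i : Space n)
  have hw : ∀ i, 1 ≤ w i := fun i => one_le_expWeight hα2 hM0 _
  have hw0 : ∀ i, 0 < w i := fun i => zero_lt_one.trans_le (hw i)
  have hwC : ∀ i, ‖(w i : ℂ)‖ ≤ Real.exp (αU / 2 * M) := fun i => by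
    rw [Complex.norm_real, Real.norm_of_nonneg (hw0 i).le]
    exact expWeight_le hα2 _
  have hconj : SchurBound
      (fun i j => couplingMatrix k₀ U G i j * ((w i / w j - 1 : ℝ) : ℂ)) β := by
    rw [← hrS]
    refine schurBound_of_exp_decay hGd hκ hS hr0 fun i j => ?_
    rw [norm_mul, Complex.norm_real, Real.norm_eq_abs]
    calc _ ≤ r * (Real.exp (-(αU / 2) * ‖(i : Space n) - j‖) *
          Real.exp (-(αU / 2) * ‖(i : Space n) - j‖)) *
          Real.exp (αU / 2 * ‖(i : Space n) - j‖) :=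
          mul_le_mul (hbnorm i j) (abs_expWeight_div_sub_one_le hα2 _ _) (abs_nonneg _)
            (by positivity)
      _ = _ := by
          rw [mul_assoc, mul_assoc, ← Real.exp_add]
          simp
  have hfin : {i : G | ‖(i : Space n)‖ ≤ M}.Finite := by
    refine Set.Finite.preimage Subtype.val_injective.injOn
      ((finite_norm_le_of_separated hκ
        (fun x hx y hy => kappaStar_le_dist hκ hx hy) M).subset fun x hx => ?_ :
        {x : Space n | x ∈ G ∧ ‖x‖ ≤ M}.Finite) |>.subset fun i hi => ⟨i.2, hi⟩
    exact ⟨hGd hx.1, hx.2⟩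
  set N : Finset G := hfin.toFinset
  have hN : ∀ i : G, i ∈ N ↔ ‖(i : Space n)‖ ≤ M := fun i => hfin.mem_toFinset
  let r' : G → G → ℂ := fun i j =>
    if i ∈ N ∧ j ∈ N then 0 else couplingMatrix k₀ U G i j / w j
  have hr' : SchurBound r' (Real.exp (-(αU / 2 * M)) * β) := by
    rw [← hrS, ← mul_assoc]
    refine schurBound_of_exp_decay hGd hκ hS (by positivity) fun i j => ?_
    by_cases hij : i ∈ N ∧ j ∈ N
    · simp only [r', if_pos hij, norm_zero]
      positivity
    · simp only [r', if_neg hij, norm_div]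
      rw [Complex.norm_real, Real.norm_of_nonneg (hw0 j).le]
      have h1 := exp_div_expWeight_le (M := M) hα2 (g := (i : Space n)) (h := j)
        (by rwa [hN, hN] at hij)
      calc _ ≤ r * (Real.exp (-(αU / 2) * ‖(i : Space n) - j‖) *
            Real.exp (-(αU / 2) * ‖(i : Space n) - j‖)) / w j :=
            div_le_div_of_nonneg_right (hbnorm i j) (hw0 j).le
        _ = r * Real.exp (-(αU / 2) * ‖(i : Space n) - j‖) *
            (Real.exp (-(αU / 2) * ‖(i : Space n) - j‖) / w j) := by ring
        _ ≤ r * Real.exp (-(αU / 2) * ‖(i : Space n) - j‖) * Real.exp (-(αU / 2 * M)) :=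
            mul_le_mul_of_nonneg_left h1 (by positivity)
        _ = _ := by ring
  let L : Set G := {i | (i : Space n) ∈ gLOLZ Λ k₀}
  have hNsq : ∀ i ∈ N, ‖(i : Space n)‖ ^ 2 ≤ μ * ‖k₀‖ := fun i hi => by
    rw [← hM2]
    exact pow_le_pow_left₀ (norm_nonneg _) ((hN i).1 hi) 2
  have hgap : ∀ i ∈ N, i ∈ L → ∀ j ∈ N, j ∉ L → Real.pi * h₀ / 4 ≤
      |Real.pi * sigma k₀ i / rho k₀ i - Real.pi * sigma k₀ j / rho k₀ j| := by
    intro i hi hiL j hj hjL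
    -- A tangent lattice point of the ball lies within `μ / 2 ≤ κ_* / 2` of the sphere, hence in
    -- `L`; so points outside `L` are off the plane.
    have hjT : (j : Space n) ∉ tangentPlane k₀ := fun hT => by
      refine hjL ⟨hGd j.2, hT, (infDist_ewaldSphere_le hk hT).trans ?_⟩
      rw [div_le_iff₀ (by positivity)]
      nlinarith [hNsq j hj]
    exact gap_le_abs_sub hc₀ hh₀ hμ hμc hμh hμK hk (hρ i i.2) (hρ j j.2) hiL.2.1 (hNsq i hi)
      (hlayer j (hGd j.2) hjT) (hNsq j hj)
  set v := hγ.curve hρpos subset_rfl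
  set u := hL.curve hρpos hsub
  have hv0 : ‖v 0‖ = normG k₀ G (delta n) := by
    refine norm_eq_normG hρpos subset_rfl (fun i _ => ?_) fun i hi => absurd i.2 hi
    rw [hγ.curve_apply, hγ.initial, weighted]
  have herr : ‖lpProj L (v z) - u z‖ = normG k₀ (gLOLZ Λ k₀) (fun g => ψL z g - ψγ z g) := by
    rw [norm_sub_rev]
    refine norm_eq_normG hρpos hsub (fun i hi => ?_) fun i hi => ?_
    · rw [lp.coeFn_sub, Pi.sub_apply, lpProj_apply_of_mem (show i ∈ L from hi), hγ.curve_apply,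
        hL.curve_apply, weighted, mul_sub]
    · rw [lp.coeFn_sub, Pi.sub_apply, lpProj_apply_of_notMem (show i ∉ L from hi),
        hL.curve_apply_of_notMem hρpos hsub z hi, sub_zero]
  rw [← hv0, ← herr]
  refine norm_reduction_error_le hb (couplingMatrix_conj hGd hU) L N
    (W := (schurBound_diagonal (Real.exp_pos (αU / 2 * M)).le hwC).op) hw
    (fun x i => schurBound_diagonal_op_apply (Real.exp_pos _).le hwC x i) hconj (Real.exp_pos _).le hr' ?_
    (by positivity) hgap (hγ.continuous_curve hρpos subset_rfl) (hL.continuous_curve hρpos hsub)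
    (fun s i => hγ.hasDerivAt_curve hρpos subset_rfl hb s i i.2)
    (fun s i hi => hL.hasDerivAt_curve hρpos hsub hb s i hi)
    (fun s i hi => hL.curve_apply_of_notMem hρpos hsub s hi) ?_ ?_ hz
  · intro i j hij
    have hwj : (w j : ℂ) ≠ 0 := by exact_mod_cast (hw0 j).ne'
    simp only [r', if_neg hij]
    exact div_mul_cancel₀ _ hwj
  · ext i
    rw [hγ.curve_apply, hL.curve_apply, hγ.initial, hL.initial]
  · ext i
    rw [schurBound_diagonal_op_apply (Real.exp_pos _).le hwC, hγ.curve_apply, hγ.initial, mul_left_comm,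
      delta_mul_expWeight _ _ hM0]

end DHW

theorem theorem4p2 (n : ℕ) (N₀ αU αs κs h₀ c₀ : ℝ) (hN₀ : 0 < N₀) (hαU : 0 < αU)
    (hαs : 0 < αs) (hκs : 0 < κs) (hh₀ : 0 < h₀) (hc₀ : 0 < c₀) :
    ∃ ks : ℝ, 0 < ks ∧ ∃ N₁ : ℝ, 0 < N₁ ∧
      ∀ (Λ : Submodule ℤ (DHW.Space n)) [DiscreteTopology Λ] [IsZLattice ℝ Λ],
      DHW.kappaStar Λ = κs →
      ∀ k₀ : DHW.Space n,
      -- the beam enters the specimen: the cosine of the angle between `k₀` and `ν` is at least `c₀`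
      c₀ * ‖k₀‖ ≤ ⟪k₀, DHW.nu n⟫ →
      -- the dual lattice vectors in the tangent plane form a lattice of dimension `d - 1 = n`
      Module.finrank ℝ
        (Submodule.span ℝ (DHW.dualLattice Λ ∩ DHW.tangentPlane k₀)) = n →
      -- the other lattice layers stay at distance at least `h₀` from the tangent plane
      (∀ g ∈ DHW.dualLattice Λ, g ∉ DHW.tangentPlane k₀ →
        h₀ ≤ Metric.infDist g (DHW.tangentPlane k₀)) →
      ∀ (CU : ℝ) (U : DHW.Space n → ℂ), 0 < CU →
      (∀ g ∈ DHW.dualLattice Λ, U (-g) = (starRingEnd ℂ) (U g)) →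
      (∀ g ∈ DHW.dualLattice Λ, ‖U g‖ ≤ CU * Real.exp (-αU * ‖g‖)) →
      ∀ ψγ ψL : ℝ → DHW.Space n → ℂ,
      DHW.IsSolution k₀ U (DHW.gGamma Λ k₀ (1 / 2)) ψγ →
      DHW.IsSolution k₀ U (DHW.gLOLZ Λ k₀) ψL →
      ∀ zs : ℝ, ks ≤ ‖k₀‖ →
      zs ≤ N₀ * (αs * ‖k₀‖) ^ (1 / 3 : ℝ) * (‖k₀‖ / CU) →
      DHW.gLOLZ Λ k₀ ⊆ DHW.gGamma Λ k₀ (1 / 2) ∧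
      ∀ z ∈ Set.Icc 0 zs,
        DHW.normG k₀ (DHW.gLOLZ Λ k₀) (fun g => ψL z g - ψγ z g) ≤
          N₁ * (1 / (αs * ‖k₀‖) ^ 2 + αs * CU ^ 2 / ‖k₀‖ ^ 2 * zs) *
            DHW.normG k₀ (DHW.gGamma Λ k₀ (1 / 2)) (DHW.delta n) := by
  -- `S` depends on the separation only, which makes all constants uniform over the lattices.
  obtain ⟨S, hS0, hS⟩ := exists_sum_exp_neg_norm_le (DHW.Space n) hκs (half_pos hαU)
  set q := 2 * Real.pi * S / c₀ with hq
  have hq0 : 0 < q := by positivity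
  set μ := min (min (c₀ * h₀ / 8) h₀) κs with hμ
  have hμ0 : 0 < μ := by positivity
  obtain ⟨k₁, hk₁, hasymp⟩ := DHW.exists_forall_mul_exp_le (p := q * N₀) (s := αs) (β := αU / 2)
    (μ := μ) hαs (half_pos hαU) hμ0
  set c := Real.pi * h₀ / 4 with hc
  have hc0 : 0 < c := by positivity
  -- `k₁` serves the exponential comparison, the other two thresholds the inclusion of the LOLZ. In
  -- `N₁`, the `1` covers the exponentially small term and the quotient the quadratic one.
  refine ⟨max k₁ (max κs (8 * κs / c₀ ^ 2)), by positivity, 1 + 3 * q ^ 2 / (c * αs),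
    by positivity, ?_⟩
  intro Λ _ _ hκ k₀ hkν _ hlayer CU U hCU hU hUb ψγ ψL hγ hL zs hks hzs
  have hK1 : k₁ ≤ ‖k₀‖ := (le_max_left _ _).trans hks
  have hKκ : κs ≤ ‖k₀‖ := (le_max_left _ _).trans ((le_max_right _ _).trans hks)
  have hKc : 8 * κs / c₀ ^ 2 ≤ ‖k₀‖ := (le_max_right _ _).trans ((le_max_right _ _).trans hks)
  have hK : 0 < ‖k₀‖ := hk₁.trans_le hK1
  have hμκ : μ ≤ κs := min_le_right _ _
  have hsub : DHW.gLOLZ Λ k₀ ⊆ DHW.gGamma Λ k₀ (1 / 2) := by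
    refine DHW.gLOLZ_subset_gGamma hc₀ hkν (hκ ▸ hκs) (hκ ▸ hKκ) ?_
    rw [hκ]
    rwa [div_le_iff₀' (by positivity)] at hKc
  refine ⟨hsub, fun z hz => ?_⟩
  have hbound := DHW.normG_gLOLZ_sub_le hαU hh₀ hc₀ hμ0 (norm_pos_iff.1 hK) (hκ ▸ hκs) hkν hlayer
    (hκ ▸ hS) (by have := (min_le_left _ κs).trans (min_le_left (c₀ * h₀ / 8) h₀); linarith)
    ((min_le_left _ _).trans (min_le_right _ _)) (hκ ▸ hμκ) (hμκ.trans hKκ) hsub hCU hU hUb hγ hL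
    rfl hz.1
  refine hbound.trans (mul_le_mul_of_nonneg_right ?_ (Real.sqrt_nonneg _))
  set τ := (αs * ‖k₀‖) ^ (1 / 3 : ℝ) with hτ
  have hτ0 : 0 ≤ τ := by positivity
  -- Here the restriction on the thickness enters: it keeps the exponent of the weight growth at
  -- order `‖k₀‖ ^ (1 / 3)`.
  have hβz : q * (CU / ‖k₀‖) * z ≤ q * N₀ * τ := by
    have h1 : z ≤ N₀ * τ * (‖k₀‖ / CU) := hz.2.trans hzs
    calc q * (CU / ‖k₀‖) * z ≤ q * (CU / ‖k₀‖) * (N₀ * τ * (‖k₀‖ / CU)) := by gcongr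
      _ = _ := by field_simp
  have hz0 := hz.1
  have hsmall : Real.exp (-(αU / 2 * √(μ * ‖k₀‖))) * (q * (CU / ‖k₀‖)) *
      Real.exp (q * (CU / ‖k₀‖) * z) * z ≤ 1 / (αs * ‖k₀‖) ^ 2 := by
    refine le_trans ?_ (hasymp ‖k₀‖ hK1)
    rw [sub_eq_neg_add, Real.exp_add]
    calc _ = (q * (CU / ‖k₀‖) * z) * (Real.exp (-(αU / 2 * √(μ * ‖k₀‖))) *
          Real.exp (q * (CU / ‖k₀‖) * z)) := by ring
      _ ≤ _ := by gcongr
  have hmain : 3 * (q * (CU / ‖k₀‖)) ^ 2 / c * z ≤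
      3 * q ^ 2 / (c * αs) * (αs * CU ^ 2 / ‖k₀‖ ^ 2 * zs) := by
    calc _ ≤ 3 * (q * (CU / ‖k₀‖)) ^ 2 / c * zs := by gcongr; exact hz.2
      _ = _ := by field_simp
  have hzs0 : 0 ≤ zs := hz.1.trans hz.2
  have h1 : 0 ≤ αs * CU ^ 2 / ‖k₀‖ ^ 2 * zs := by positivity
  have h2 : 0 ≤ 3 * q ^ 2 / (c * αs) * (1 / (αs * ‖k₀‖) ^ 2) := by positivity
  change (3 * (q * (CU / ‖k₀‖)) ^ 2 / c + Real.exp (-(αU / 2 * √(μ * ‖k₀‖))) *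
    (q * (CU / ‖k₀‖)) * Real.exp (q * (CU / ‖k₀‖) * z)) * z ≤ _
  rw [add_mul]
  refine (add_le_add hmain hsmall).trans ?_
  rw [one_add_mul, mul_add]
  linarith
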